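/- **Setting.** Let $G=(V,E,L)$ be a finite labeled directed graph over a finite alphabet $\Sigma$ (edge $e$ goes from $\sigma(e)$ to $\tau(e)$; parallel edges are allowed) that is deterministic (distinct edges leaving the same vertex have distinct labels) and primitive (for some $N\ge 1$ every two vertices are joined by a path of length exactly $N$). Fix a root $v_{\rm root}\in V$ and a linear order on $E$. $S(G)$ is the set of label words of finite paths of $G$, and $\mathrm{cap}(S(G))=\lim_{\ell}\frac1\ell\log_2|S(G)\cap\Sigma^\ell|$. A Markov chain on $G$ is a probability mass function $P$ on $E$; put $\pi(u)=\sum_{\sigma(e)=u}P(e)$ and $P_{\min}=\min_e P(e)$. $P$ is stationary if $\pi(u)=\sum_{\tau(e)=u}P(e)$ for all $u$, positive if $P_{\min}>0$, and $n$-integral if all $nP(e)$ are integers. $H(P)=-\sum_e P(e)\log_2\frac{P(e)}{\pi(\sigma(e))}$, and a stationary $P$ is maxentropic if it maximizes $H$ among all stationary chains on $G$. **Construction.** Let $n\ge1$, $\alpha\in(0,1)$, $n'=\lfloor\alpha n\rfloor$, let $P$ be stationary, positive and $n$-integral, and $0<\zeta<\frac{1-\alpha}{\alpha}P_{\min}$.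 $G_n$ is the multigraph with $nP(e)$ copies of each edge $e$, and $\mathcal C_{\rm wcc}$ is the set of label words of its Eulerian cycles. $\mathcal W$ is the set of paths $\mathbf w$ of length $n'$ in $G$ from $v_{\rm root}$ with $|S(e)/n'-P(e)|<\zeta$ for all $e$, where $S(e)$ is the number of occurrences of $e$ in $\mathbf w$. The residual multigraph of $\mathbf w$ has $nP(e)-S(e)$ copies of each $e$; $\Phi(\mathbf w)$ is its lexicographically first Eulerian path (as a sequence of edges of $G$) from the end of $\mathbf w$ to $v_{\rm root}$. Put $\mathcal C_{\rm pool}=\{L(\mathbf w\,\|\,\Phi(\mathbf w)):\mathbf w\in\mathcal W\}$ and $R_{\rm pool}=\frac1n\log_2|\mathcal C_{\rm pool}|$. **Theorem.** 1. (Exact constraints.) For every $\mathbf w\in\mathcal W$, $S(e)<nP(e)$ for all $e$ and $\Phi(\mathbf w)$ exists. All words of $\mathcal C_{\rm pool}$ have length $n$, $\mathcal C_{\rm pool}\subseteq\mathcal C_{\rm wcc}$, each of them lies in $S(G)$ and is the label word of a path whose empirical edge frequencies are exactly $P(e)$, $e\in E$ (the weakly constrained system with the edge-indicator function, target $P$ and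 tolerance $0$), and $|\mathcal C_{\rm pool}|=|\mathcal W|$. 2. (Finite-length bound.) Suppose moreover that $n'\ge1$ and that $P$ is $n'$-integral. Let $N_v$ be the number of paths of length $n'$ from $v_{\rm root}$ to $v$ that use each edge $e$ exactly $n'P(e)$ times, and $F^*=(\delta_{ij}-P(i,j)/\pi(i))_{i,j\in V}$ with $P(i,j)=\sum_{e:i\to j}P(e)$; let $F^*_{\rm root}$ be its $(v_{\rm root},v_{\rm root})$ cofactor. Then $\sum_{v}N_v\le|\mathcal C_{\rm pool}|$, $N_v=0$ for $v\ne v_{\rm root}$, $F^*_{\rm root}>0$, $$N_{v_{\rm root}}=\frac{\prod_{i\in V}(n'\pi(i))!}{\prod_{e\in E}(n'P(e))!}\,F^*_{\rm root},\qquad |\mathcal C_{\rm pool}|\ \ge\ N_{v_{\rm root}}\ \ge\ 2^{\,n'H(P)+\frac{|V|-|E|}{2}\log_2(2\pi n')+\Delta(n')+C_{\rm root}},$$ where the $\pi$ in $2\pi n'$ is the circle constant, $\Delta(n')=\log_2(\mathrm e)\left(\sum_{i\in V}\frac1{12n'\pi(i)+1}-\sum_{e\in E}\frac1{12n'P(e)}\right)$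 and $C_{\rm root}=\frac12\left(\sum_u\log_2\pi(u)-\sum_e\log_2P(e)\right)+\log_2F^*_{\rm root}$. Consequently $R_{\rm pool}\ge\frac1n\left(n'H(P)+\frac{|V|-|E|}2\log_2(2\pi n')+\Delta(n')+C_{\rm root}\right)$. 3. (Rate.) Let $P$ be stationary and positive, $n_k\to\infty$, and let $P_k\to P$ be stationary, positive, $n_k$-integral chains (for instance $P_k=P$). Let $\alpha\in(0,1)$ and let $0<\zeta_k<\frac{1-\alpha}\alpha (P_k)_{\min}$ with $n_k\zeta_k\to\infty$ (for instance $\zeta_k$ constant). Let $R_k$ be the rate of the pool for $(n_k,P_k,\alpha,\zeta_k)$. Then $\liminf_kR_k\ge\alpha H(P)$, and if moreover $\zeta_k\to0$, then $\lim_kR_k=\alpha H(P)$. 4. (Capacity.) The limit defining $\mathrm{cap}(S(G))$ exists and a maxentropic chain exists. Every maxentropic chain $P$ is positive and has $H(P)=\mathrm{cap}(S(G))$; there are $C,n_0$ such that for all $n\ge n_0$ there is a stationary, positive, $n$-integral chain $Q$ with $|P(e)-Q(e)|\le C/n$ for all $e$. For every $n_k\to\infty$, all stationary, positive, $n_k$-integral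 $P_k\to P$, and, for each $\alpha\in(0,1)$, all $0<\zeta_{\alpha,k}<\frac{1-\alpha}\alpha(P_k)_{\min}$ with $n_k\zeta_{\alpha,k}\to\infty$ (not necessarily $\zeta_{\alpha,k}\to0$), the rates satisfy $\lim_kR_k(\alpha)=\alpha\,\mathrm{cap}(S(G))$ for each $\alpha\in(0,1)$, and hence $\lim_{\alpha\to1^-}\lim_kR_k(\alpha)=\mathrm{cap}(S(G))$. -/

import Mathlib

open Filter Topology
open scoped BigOperators

/-- A labeled directed graph with vertex set `V`, edge set `E` and label alphabet `A`
(parallel edges are allowed). -/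
structure LabeledGraph (V E A : Type*) where
  /-- initial vertex of an edge -/
  src : E → V
  /-- terminal vertex of an edge -/
  tgt : E → V
  /-- label of an edge -/
  label : E → A

namespace LabeledGraph

variable {V E A : Type*}

/-- At most one edge with a given label leaves each vertex. -/
def IsDeterministic (G : LabeledGraph V E A) : Prop :=
  ∀ e f : E, G.src e = G.src f → G.label e = G.label f → e = f

/-- `G.IsWalk u p v`: the edge sequence `p` is a path of `G` from `u` to `v`. -/
def IsWalk (G : LabeledGraph V E A) : V → List E → V → Prop
  | u, [], v => u = v
  | u, e :: p, v => G.src e = u ∧ G.IsWalk (G.tgt e) p v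

/-- The terminal vertex of the path `p` started at `u`. -/
def endVertex (G : LabeledGraph V E A) : V → List E → V
  | u, [] => u
  | _, e :: p => G.endVertex (G.tgt e) p

/-- The label sequence of a path. -/
def word (G : LabeledGraph V E A) (p : List E) : List A := p.map G.label

/-- For some `N > 0`, any two vertices are joined by a path of length exactly `N`. -/
def IsPrimitive (G : LabeledGraph V E A) : Prop :=
  ∃ N : ℕ, 0 < N ∧ ∀ u v : V, ∃ p : List E, G.IsWalk u p v ∧ p.length = N

/-- A path from `u` to `v` that traverses every edge exactly once. For `u = v` this is an
Eulerian cycle. -/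
def IsEulerianPath (G : LabeledGraph V E A) (u : V) (p : List E) (v : V) : Prop :=
  G.IsWalk u p v ∧ p.Nodup ∧ ∀ e : E, e ∈ p

/-- The multigraph obtained by replacing each edge `e` by `m e` parallel copies. -/
def replicate (G : LabeledGraph V E A) (m : E → ℕ) :
    LabeledGraph V (Σ e : E, Fin (m e)) A where
  src x := G.src x.1
  tgt x := G.tgt x.1
  label x := G.label x.1

/-- The constrained system `S(G)`. -/
def constrainedSystem (G : LabeledGraph V E A) : Set (List A) :=
  {c | ∃ (u : V) (p : List E) (v : V), G.IsWalk u p v ∧ G.word p = c}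

/-- `(1/ℓ) log₂ |S(G) ∩ A^ℓ|`. -/
noncomputable def growthRate (G : LabeledGraph V E A) (l : ℕ) : ℝ :=
  1 / (l : ℝ) * Real.logb 2 ((G.constrainedSystem ∩ {c | c.length = l}).ncard : ℝ)

/-- The capacity of `S(G)`, the limit of the growth rates. -/
noncomputable def capacity (G : LabeledGraph V E A) : ℝ :=
  limUnder atTop G.growthRate

/-- The empirical Markov chain `P_γ` of a path. -/
noncomputable def empirical [DecidableEq E] (p : List E) (e : E) : ℝ :=
  1 / (p.length : ℝ) * (p.count e : ℝ)

/-- The `(φ, r, ε)`-weakly constrained system. -/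
def weaklyConstrainedSystem [Fintype E] [DecidableEq E] {T : Type*} (G : LabeledGraph V E A)
    (φ : E → T → ℝ) (r : T → ℝ) (ε : ℕ → ℝ) : Set (List A) :=
  {c | c ∈ G.constrainedSystem ∧
    ∃ (u : V) (p : List E) (v : V), G.IsWalk u p v ∧ G.word p = c ∧
      ∀ s : T, |(∑ e, empirical p e * φ e s) - r s| ≤ ε p.length}

/-- The edge indicator vectors. -/
noncomputable def edgeIndicator [DecidableEq E] (e : E) : E → ℝ := Pi.single e 1

end LabeledGraph

/-- A Markov chain on a graph with edge set `E`: a probability mass function on the edges. -/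
structure EdgeChain (E : Type*) [Fintype E] where
  /-- the probability of an edge -/
  prob : E → ℝ
  nonneg : ∀ e, 0 ≤ prob e
  sum_eq_one : ∑ e, prob e = 1

namespace EdgeChain

variable {V E A : Type*} [Fintype E]

/-- The induced distribution `π(u) = ∑_{σ(e) = u} P(e)`. -/
noncomputable def vertexProb [DecidableEq V] (P : EdgeChain E) (G : LabeledGraph V E A)
    (u : V) : ℝ := ∑ e with G.src e = u, P.prob e

/-- Stationarity: `π(u) = ∑_{τ(e) = u} P(e)`. -/
def IsStationary [DecidableEq V] (P : EdgeChain E) (G : LabeledGraph V E A) : Prop :=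
  ∀ u : V, P.vertexProb G u = ∑ e with G.tgt e = u, P.prob e

/-- Every edge has positive probability. -/
def IsPositive (P : EdgeChain E) : Prop := ∀ e, 0 < P.prob e

/-- `n P(e)` is an integer for every edge. -/
def IsIntegral (P : EdgeChain E) (n : ℕ) : Prop := ∀ e, ∃ k : ℕ, (n : ℝ) * P.prob e = k

/-- The entropy rate in bits. -/
noncomputable def entropyRate [DecidableEq V] (P : EdgeChain E) (G : LabeledGraph V E A) : ℝ :=
  -∑ e, P.prob e * Real.logb 2 (P.prob e / P.vertexProb G (G.src e))

/-- `P` maximizes the entropy rate among all stationary Markov chains on `G`. -/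
def IsMaxentropic [DecidableEq V] (P : EdgeChain E) (G : LabeledGraph V E A) : Prop :=
  P.IsStationary G ∧ ∀ Q : EdgeChain E, Q.IsStationary G → Q.entropyRate G ≤ P.entropyRate G

/-- `P_min`, the least edge probability. -/
noncomputable def pMin (P : EdgeChain E) : ℝ := ⨅ e, P.prob e

/-- The matrix `δ_ij - P(i,j)/π(i)`, where `P(i,j)` is the total mass of the edges
from `i` to `j`. -/
noncomputable def whittleMatrix [DecidableEq V] (P : EdgeChain E) (G : LabeledGraph V E A) :
    Matrix V V ℝ :=
  Matrix.of fun i j => (if i = j then 1 else 0) -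
    (∑ e with G.src e = i ∧ G.tgt e = j, P.prob e) / P.vertexProb G i

/-- The `(i, j)`-th cofactor of the Whittle matrix, i.e. the `(j, i)` entry of its adjugate. -/
noncomputable def whittleCofactor [Fintype V] [DecidableEq V] (P : EdgeChain E)
    (G : LabeledGraph V E A) (i j : V) : ℝ := (P.whittleMatrix G).adjugate j i

/-- The multiplicities `n P(e)` (for an `n`-integral chain the floor does nothing). -/
noncomputable def multiplicity (P : EdgeChain E) (n : ℕ) (e : E) : ℕ := ⌊(n : ℝ) * P.prob e⌋₊

/-- The codebook `C_wcc`: the label sequences of the Eulerian cycles of `G_n`. -/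
def eulerCodebook (P : EdgeChain E) (G : LabeledGraph V E A) (n : ℕ) : Set (List A) :=
  {c | ∃ (v : V) (p : List (Σ e : E, Fin (P.multiplicity n e))),
    (G.replicate (P.multiplicity n)).IsEulerianPath v p v ∧
      (G.replicate (P.multiplicity n)).word p = c}

end EdgeChain

/-- `n' = ⌊α n⌋`. -/
noncomputable def headLength (α : ℝ) (n : ℕ) : ℕ := ⌊α * (n : ℝ)⌋₊

/-- The admissible range `0 < ζ < ((1 - α)/α) P_min` of the typicality parameter. -/
def IsTypicality {E : Type*} [Fintype E] (P : EdgeChain E) (α ζ : ℝ) : Prop :=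
  0 < ζ ∧ ζ < (1 - α) / α * P.pMin

section Pool

variable {V E A : Type*} [Fintype E] [LinearOrder E]

/-- The set `W` of `ζ`-typical paths of length `n'` that start at `root`. -/
def admissiblePrefixes (G : LabeledGraph V E A) (P : EdgeChain E) (root : V) (α ζ : ℝ) (n : ℕ) :
    Set (List E) :=
  {w | (∃ v, G.IsWalk root w v) ∧ w.length = headLength α n ∧
    ∀ e, |(w.count e : ℝ) / (headLength α n : ℝ) - P.prob e| < ζ}

/-- The multiplicities `R(e) = n P(e) - S(e)` of the residual multigraph of `w`. -/
noncomputable def residualMult (P : EdgeChain E) (n : ℕ) (w : List E) (e : E) : ℕ :=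
  P.multiplicity n e - w.count e

/-- The Eulerian paths of the residual multigraph from the end of `w` back to `root`, read as
sequences of edges of `G`. -/
def completions (G : LabeledGraph V E A) (P : EdgeChain E) (root : V) (n : ℕ) (w : List E) :
    Set (List E) :=
  {x | ∃ p : List (Σ e : E, Fin (residualMult P n w e)),
    (G.replicate (residualMult P n w)).IsEulerianPath (G.endVertex root w) p root ∧
      p.map Sigma.fst = x}

open Classical in
/-- The map `Φ`: the lexicographically first completion (`≤` on lists is the lexicographic
order). -/
noncomputable def firstCompletion (G : LabeledGraph V E A) (P : EdgeChain E) (root : V) (n : ℕ)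
    (w : List E) : List E :=
  if h : ∃ x, IsLeast (completions G P root n w) x then h.choose else []

/-- The codebook `C_pool`. -/
noncomputable def pool (G : LabeledGraph V E A) (P : EdgeChain E) (root : V) (α ζ : ℝ) (n : ℕ) :
    Set (List A) :=
  (fun w => G.word (w ++ firstCompletion G P root n w)) '' admissiblePrefixes G P root α ζ n

/-- The rate `R_pool = (1/n) log₂ |C_pool|`. -/
noncomputable def poolRate (G : LabeledGraph V E A) (P : EdgeChain E) (root : V) (α ζ : ℝ)
    (n : ℕ) : ℝ :=
  1 / (n : ℝ) * Real.logb 2 ((pool G P root α ζ n).ncard : ℝ)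

/-- The number of paths of length `m` from `u` to `v` whose transition counts are exactly
`m P(e)`. -/
noncomputable def exactCount (G : LabeledGraph V E A) (P : EdgeChain E) (u v : V) (m : ℕ) : ℕ :=
  {w : List E | G.IsWalk u w v ∧ w.length = m ∧ ∀ e, (w.count e : ℝ) = (m : ℝ) * P.prob e}.ncard

end Pool

section Bound

variable {V E A : Type*} [Fintype V] [DecidableEq V] [Fintype E]

/-- The correction term `Δ(m)` from Stirling's bounds. -/
noncomputable def stirlingDelta (G : LabeledGraph V E A) (P : EdgeChain E) (m : ℕ) : ℝ :=
  Real.logb 2 (Real.exp 1) *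
    ((∑ i, 1 / (12 * (m : ℝ) * P.vertexProb G i + 1)) - ∑ e, 1 / (12 * (m : ℝ) * P.prob e))

/-- The constant `C_v`. -/
noncomputable def poolConstant (G : LabeledGraph V E A) (P : EdgeChain E) (root v : V) : ℝ :=
  1 / 2 * ((∑ u, Real.logb 2 (P.vertexProb G u)) - ∑ e, Real.logb 2 (P.prob e)) +
    Real.logb 2 (P.whittleCofactor G v root)

/-- `m H(P) + ((|V| - |E|)/2) log₂(2 π m) + Δ(m) + C_root`. -/
noncomputable def poolExponent (G : LabeledGraph V E A) (P : EdgeChain E) (root : V) (m : ℕ) : ℝ :=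
  (m : ℝ) * P.entropyRate G +
    ((Fintype.card V : ℝ) - (Fintype.card E : ℝ)) / 2 * Real.logb 2 (2 * Real.pi * (m : ℝ)) +
    stirlingDelta G P m + poolConstant G P root root

end Bound

/-! Put n' = ⌊αn⌋. For `w` in W the bound S(e)/n' < P(e) + ζ < P(e)/α gives S(e) < nP(e), so every
edge survives in the residual multigraph. Since nP is a circulation, that multigraph has the
divergence of a walk from the end of `w` to the root, and Euler's theorem supplies a completion. All
codewords come from walks starting at the root, so determinism recovers the walk from its label, and
its first n' edges are `w`. Hence the pool has as many elements as W (`ncard_pool`).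

The count rests on Whittle's formula (`ncard_typedWalks_eq`): the number of walks with prescribed
edge counts is a quotient of factorials times a cofactor. It is proved by removing the first edge,
under which the cofactor satisfies the matching recursion (`weightCofactor_eq_sum`). By the maximum
principle the cofactor does not vanish when all weights are positive (`weightCofactor_ne_zero`), so
Euler's theorem and the positivity of the root cofactor both follow from the formula. Robbins'
factorial bounds turn it into the explicit exponent.

For the asymptotic lower bound, the chains P_k need not be n'-integral; they are rounded to
n'-integral stationary chains at distance at most C/n' (`exists_integral_circulation`), which is
below ζ_k because n_k ζ_k tends to infinity. For the upper bound with ζ_k → 0, each typical prefix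
has Markov probability at least 2^(-n'(H(P)+o(1))), and these probabilities sum to at most 1.

For a maxentropic P, the walks of one closed type number at most 2^(M H(P)) and there are
polynomially many types, so the capacity is at most H(P); rounded chains give the converse. The
number of words of length n' then bounds the pool from above for any tolerance. Maxentropic chains
are positive because putting mass t on a missing edge gains entropy of order t log(1/t), more than
the linear loss from mixing. -/

namespace LabeledGraph

/-! ### Walks and their labels. -/

section Walks

variable {V E A : Type*} {G : LabeledGraph V E A}

theorem isWalk_append {u v : V} {p q : List E} :
    G.IsWalk u (p ++ q) v ↔ ∃ x, G.IsWalk u p x ∧ G.IsWalk x q v := by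
  induction p generalizing u with
  | nil => simp [IsWalk]
  | cons e p ih => simp [IsWalk, ih, and_assoc]

theorem IsWalk.endVertex_eq {u v : V} {p : List E} (h : G.IsWalk u p v) :
    G.endVertex u p = v := by
  induction p generalizing u with
  | nil => exact h
  | cons e p ih => exact ih h.2

/-- With a common starting vertex, each label singles out the next edge and hence the next vertex;
the end vertices need not be assumed equal. -/
theorem IsWalk.word_injective (hG : G.IsDeterministic) {u v v' : V} {p q : List E}
    (hp : G.IsWalk u p v) (hq : G.IsWalk u q v') (h : G.word p = G.word q) : p = q := by
  induction p generalizing u q with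
  | nil => cases q with
    | nil => rfl
    | cons f q => simp [word] at h
  | cons e p ih => cases q with
    | nil => simp [word] at h
    | cons f q =>
      simp only [word, List.map_cons, List.cons.injEq] at h
      obtain rfl := hG e f (hp.1.trans hq.1.symm) h.1
      rw [ih hp.2 hq.2 h.2]

theorem isWalk_replicate {m : E → ℕ} {u v : V} {p : List (Σ e : E, Fin (m e))} :
    (G.replicate m).IsWalk u p v ↔ G.IsWalk u (p.map Sigma.fst) v := by
  induction p generalizing u with
  | nil => rfl
  | cons e p ih => simp only [IsWalk, List.map_cons, ih]; rfl

theorem word_replicate {m : E → ℕ} (p : List (Σ e : E, Fin (m e))) :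
    (G.replicate m).word p = G.word (p.map Sigma.fst) := by
  simp only [word, List.map_map]; rfl

theorem IsPrimitive.exists_isWalk (hG : G.IsPrimitive) (u v : V) : ∃ p, G.IsWalk u p v := by
  obtain ⟨N, -, h⟩ := hG
  obtain ⟨p, hp, -⟩ := h u v
  exact ⟨p, hp⟩

theorem IsPrimitive.exists_src_eq (hG : G.IsPrimitive) (u : V) : ∃ e, G.src e = u := by
  obtain ⟨N, hN, h⟩ := hG
  obtain ⟨p, hp, hl⟩ := h u u
  cases p with
  | nil => simp at hl; omega
  | cons e p => exact ⟨e, hp.1⟩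

theorem finite_setOf_isWalk_length [Finite E] (u : V) (l : ℕ) :
    {w : List E | (∃ v, G.IsWalk u w v) ∧ w.length = l}.Finite :=
  (List.finite_length_eq E l).subset fun _ h => h.2

end Walks

/-! ### Edge weights and their divergence. -/

section Flow

variable {V E A R : Type*} [DecidableEq V] [Fintype E] (G : LabeledGraph V E A)

/-- The total weight of the edges that leave `i`. -/
def outFlow [AddCommMonoid R] (f : E → R) (i : V) : R := ∑ e with G.src e = i, f e

/-- The total weight of the edges that enter `i`. -/
def inFlow [AddCommMonoid R] (f : E → R) (i : V) : R := ∑ e with G.tgt e = i, f e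

/-- The edge weights `m` have the divergence of a walk from `u` to `v`. -/
def IsBalanced (m : E → ℕ) (u v : V) : Prop :=
  ∀ i, G.outFlow m i + (if i = v then 1 else 0) = G.inFlow m i + (if i = u then 1 else 0)

variable {G}

theorem sum_outFlow [Fintype V] [AddCommMonoid R] (f : E → R) :
    ∑ i, G.outFlow f i = ∑ e, f e :=
  Finset.sum_fiberwise _ _ _

theorem sum_inFlow [Fintype V] [AddCommMonoid R] (f : E → R) :
    ∑ i, G.inFlow f i = ∑ e, f e :=
  Finset.sum_fiberwise _ _ _

theorem IsWalk.isBalanced [DecidableEq E] {u v : V} {w : List E} (h : G.IsWalk u w v) :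
    G.IsBalanced (fun e => w.count e) u v := by
  induction w generalizing u with
  | nil =>
    obtain rfl : u = v := h
    intro i; simp [outFlow, inFlow]
  | cons e w ih =>
    obtain ⟨rfl, h⟩ := h
    intro i
    have := ih h i
    simp only [outFlow, inFlow, List.count_cons, Finset.sum_add_distrib, beq_iff_eq,
      Finset.sum_ite_eq, Finset.mem_filter, Finset.mem_univ, true_and] at this ⊢
    simp only [eq_comm (a := i)] at this ⊢
    omega

end Flow

/-! ### Walks with prescribed edge counts. -/

section TypedWalks

variable {V E A : Type*} [DecidableEq E] {G : LabeledGraph V E A}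

/-- The walks from `u` to `v` that use each edge `e` exactly `m e` times. -/
def typedWalks (G : LabeledGraph V E A) (m : E → ℕ) (u v : V) : Set (List E) :=
  {w | G.IsWalk u w v ∧ ∀ e, w.count e = m e}

variable [Fintype E]

theorem sum_count_eq_length (w : List E) : ∑ e, w.count e = w.length := by
  induction w with
  | nil => simp
  | cons e w ih => simp [List.count_cons, Finset.sum_add_distrib, ih]

theorem typedWalks_length {m : E → ℕ} {u v : V} {w : List E}
    (h : w ∈ G.typedWalks m u v) : w.length = ∑ e, m e := by
  rw [← sum_count_eq_length]; exact Finset.sum_congr rfl fun e _ => h.2 e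

theorem typedWalks_finite (m : E → ℕ) (u v : V) :
    (G.typedWalks m u v).Finite :=
  (List.finite_length_eq E (∑ e, m e)).subset fun _ h => typedWalks_length h

end TypedWalks

end LabeledGraph

/-! ### Eulerian paths of a replicated graph as walks with prescribed edge counts. -/

/-- This assigns distinct copies to the occurrences of each edge in a sequence with the right
counts. -/
theorem List.exists_perm_map_eq {α β : Type*} (f : α → β) {x : List β} {q : List α}
    (h : x.Perm (q.map f)) : ∃ q' : List α, q'.Perm q ∧ q'.map f = x := by
  classical
  induction x generalizing q with
  | nil =>
    have := h.nil_eq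
    exact ⟨[], by simpa using this.symm⟩
  | cons a x ih =>
    obtain ⟨b, hb, rfl⟩ := List.mem_map.1 (h.subset List.mem_cons_self)
    have hq := List.perm_cons_erase hb
    have h2 : x.Perm ((q.erase b).map f) :=
      (List.perm_cons (f b)).1 (h.trans (hq.map f))
    obtain ⟨q', hq', rfl⟩ := ih h2
    exact ⟨b :: q', (hq'.cons b).trans hq.symm, rfl⟩

section Copies

variable {E : Type*} [Fintype E] [DecidableEq E]

theorem count_map_fst_univ (m : E → ℕ) (e : E) :
    ((Finset.univ : Finset (Σ e : E, Fin (m e))).toList.map Sigma.fst).count e = m e := by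
  rw [← Multiset.coe_count, ← Multiset.map_coe, Finset.coe_toList, Multiset.count_map]
  change (Finset.univ.filter fun a : (Σ e : E, Fin (m e)) => e = a.1).card = m e
  have : (Finset.univ.filter fun a : (Σ e : E, Fin (m e)) => e = a.1) =
      (Finset.univ : Finset (Fin (m e))).map ⟨Sigma.mk e, sigma_mk_injective⟩ := by
    ext ⟨a, i⟩
    simp only [Finset.mem_filter, Finset.mem_univ, true_and, Finset.mem_map,
      Function.Embedding.coeFn_mk]
    constructor
    · rintro rfl; exact ⟨i, rfl⟩
    · rintro ⟨j, hj⟩; exact congrArg Sigma.fst hj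
  rw [this]; simp

/-- An edge sequence is the projection of an enumeration of the copies `Σ e, Fin (m e)` if and
only if it contains each edge `e` exactly `m e` times. -/
theorem exists_enumeration_iff (m : E → ℕ) (x : List E) :
    (∃ p : List (Σ e : E, Fin (m e)), (p.Nodup ∧ ∀ y, y ∈ p) ∧ p.map Sigma.fst = x) ↔
      ∀ e, x.count e = m e := by
  constructor
  · rintro ⟨p, ⟨hnd, hp⟩, rfl⟩ e
    have : p.Perm (Finset.univ : Finset (Σ e : E, Fin (m e))).toList :=
      (List.perm_ext_iff_of_nodup hnd (Finset.nodup_toList _)).2 fun y => by simp [hp y]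
    rw [(this.map Sigma.fst).count_eq, count_map_fst_univ]
  · intro h
    have : x.Perm ((Finset.univ : Finset (Σ e : E, Fin (m e))).toList.map Sigma.fst) :=
      List.perm_iff_count.2 fun e => by rw [h, count_map_fst_univ]
    obtain ⟨q, hq, rfl⟩ := List.exists_perm_map_eq Sigma.fst this
    exact ⟨q, ⟨hq.nodup_iff.2 (Finset.nodup_toList _), fun y => hq.mem_iff.2 (by simp)⟩, rfl⟩

end Copies

section Codebooks

variable {V E A : Type*} [Fintype E]

theorem mem_completions_iff [LinearOrder E] {G : LabeledGraph V E A}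
    {P : EdgeChain E} {root : V} {n : ℕ} {w x : List E} :
    x ∈ completions G P root n w ↔
      x ∈ G.typedWalks (residualMult P n w) (G.endVertex root w) root := by
  simp only [LabeledGraph.typedWalks, Set.mem_ofPred_eq, ← exists_enumeration_iff, completions,
    LabeledGraph.IsEulerianPath, LabeledGraph.isWalk_replicate]
  constructor
  · rintro ⟨p, ⟨h1, h2⟩, rfl⟩; exact ⟨h1, p, h2, rfl⟩
  · rintro ⟨h1, p, h2, rfl⟩; exact ⟨p, ⟨h1, h2⟩, rfl⟩

theorem mem_eulerCodebook_iff [DecidableEq E] {G : LabeledGraph V E A}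
    {P : EdgeChain E} {n : ℕ} {c : List A} :
    c ∈ P.eulerCodebook G n ↔
      ∃ v, ∃ x ∈ G.typedWalks (P.multiplicity n) v v, G.word x = c := by
  simp only [LabeledGraph.typedWalks, Set.mem_ofPred_eq, ← exists_enumeration_iff,
    EdgeChain.eulerCodebook, LabeledGraph.IsEulerianPath, LabeledGraph.isWalk_replicate,
    LabeledGraph.word_replicate]
  constructor
  · rintro ⟨v, p, ⟨h1, h2⟩, rfl⟩; exact ⟨v, _, ⟨h1, p, h2, rfl⟩, rfl⟩
  · rintro ⟨v, _, ⟨h1, p, h2, rfl⟩, rfl⟩; exact ⟨v, p, ⟨h1, h2⟩, rfl⟩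

end Codebooks

/-- In the induction for Whittle's formula this serves twice: for the out-flows in the numerator and
for the edge counts in the denominator. -/
theorem Finset.prod_factorial_eq_mul {ι : Type*} [Fintype ι] [DecidableEq ι] (f : ι → ℕ) {a : ι}
    (ha : 0 < f a) :
    ∏ i, (f i).factorial = f a * ∏ i, ((f - Pi.single a 1 : ι → ℕ) i).factorial := by
  have h1 := Finset.mul_prod_erase Finset.univ (fun i => (f i).factorial) (Finset.mem_univ a)
  have h2 := Finset.mul_prod_erase Finset.univ
    (fun i => ((f - Pi.single a 1 : ι → ℕ) i).factorial) (Finset.mem_univ a)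
  have h3 : ∏ i ∈ Finset.univ.erase a, ((f - Pi.single a 1 : ι → ℕ) i).factorial =
      ∏ i ∈ Finset.univ.erase a, (f i).factorial :=
    Finset.prod_congr rfl fun i hi => by simp [Finset.ne_of_mem_erase hi]
  rw [← h1, ← h2, h3, ← mul_assoc]
  simp [Nat.mul_factorial_pred ha.ne']

namespace LabeledGraph

/-! ### Cofactors of the transition matrix and their recursion. -/

section WeightMatrix

variable {V E A : Type*} [DecidableEq V] [Fintype E]

/-- The matrix `δ_ij - p(i,j)/p(i)` of an edge weighting `p`. -/
noncomputable def weightMatrix (G : LabeledGraph V E A) (p : E → ℝ) : Matrix V V ℝ :=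
  Matrix.of fun i j => (if i = j then 1 else 0) -
    (∑ e with G.src e = i ∧ G.tgt e = j, p e) / G.outFlow p i

/-- The `(v, u)` cofactor of the weight matrix. -/
noncomputable def weightCofactor [Fintype V] (G : LabeledGraph V E A) (p : E → ℝ) (u v : V) : ℝ :=
  ((G.weightMatrix p).updateRow v (Pi.single u 1)).det

variable {G : LabeledGraph V E A}

theorem weightMatrix_row (p : E → ℝ) (u : V) :
    G.weightMatrix p u = Pi.single u 1 -
      (G.outFlow p u)⁻¹ • ∑ e with G.src e = u, p e • (Pi.single (G.tgt e) 1 : V → ℝ) := by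
  ext j
  simp only [weightMatrix, Matrix.of_apply, Pi.sub_apply, Pi.smul_apply, Finset.sum_apply,
    smul_eq_mul, Pi.single_apply, mul_ite, mul_one, mul_zero, div_eq_inv_mul,
    ← Finset.sum_filter, Finset.filter_filter]
  simp only [eq_comm]

theorem weightMatrix_mulVec [Fintype V] (p : E → ℝ) (x : V → ℝ) (u : V) :
    (G.weightMatrix p).mulVec x u =
      x u - (G.outFlow p u)⁻¹ * ∑ e with G.src e = u, p e * x (G.tgt e) := by
  rw [Matrix.mulVec, weightMatrix_row, sub_dotProduct, smul_dotProduct, sum_dotProduct]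
  simp

variable [DecidableEq E]

theorem outFlow_sub_single (p : E → ℝ) (e : E) :
    G.outFlow (p - Pi.single e 1) = G.outFlow p - Pi.single (G.src e) 1 := by
  ext i
  simp only [outFlow, Pi.sub_apply, Finset.sum_sub_distrib, Pi.single_apply,
    Finset.sum_ite_eq', Finset.mem_filter, Finset.mem_univ, true_and]
  simp only [eq_comm]

/-- Lowering the weight of one edge affects only the row of its source, so cofactors before and
after differ by row operations. -/
theorem weightMatrix_sub_single (p : E → ℝ) (e : E) :
    G.weightMatrix (p - Pi.single e 1) = (G.weightMatrix p).updateRow (G.src e)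
      (Pi.single (G.src e) 1 - (G.outFlow p (G.src e) - 1)⁻¹ •
        ((∑ f with G.src f = G.src e, p f • (Pi.single (G.tgt f) 1 : V → ℝ)) -
          Pi.single (G.tgt e) 1)) := by
  funext i
  by_cases hi : i = G.src e
  · subst hi
    rw [Matrix.updateRow_self, weightMatrix_row, outFlow_sub_single]
    simp [sub_smul, Finset.sum_sub_distrib, Pi.single_apply, Finset.sum_filter]
  · rw [Matrix.updateRow_ne hi, weightMatrix_row, weightMatrix_row, outFlow_sub_single]
    have : ∀ f ∈ Finset.univ.filter (fun f => G.src f = i),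
        (p - Pi.single e 1 : E → ℝ) f • (Pi.single (G.tgt f) 1 : V → ℝ) =
          p f • (Pi.single (G.tgt f) 1 : V → ℝ) := by
      intro f hf
      have : f ≠ e := by rintro rfl; exact hi (Finset.mem_filter.1 hf).2.symm
      simp [this]
    rw [Finset.sum_congr rfl this]
    simp [hi]

variable [Fintype V]

omit [DecidableEq E] in
/-- The determinant as a function of two distinct rows. -/
theorem exists_bilin_det_updateRow (M : Matrix V V ℝ) {u v : V} (h : u ≠ v) :
    ∃ B : (V → ℝ) →ₗ[ℝ] (V → ℝ) →ₗ[ℝ] ℝ,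
      (∀ a b, B a b = ((M.updateRow u a).updateRow v b).det) ∧ ∀ a, B a a = 0 := by
  have hc : ∀ a b, (M.updateRow u a).updateRow v b = (M.updateRow v b).updateRow u a := fun a b =>
    Function.update_comm h _ _ _
  refine ⟨LinearMap.mk₂ ℝ (fun a b => ((M.updateRow u a).updateRow v b).det)
    (fun a a' b => ?_) (fun c a b => ?_) (fun a b b' => ?_) (fun c a b => ?_), fun a b => rfl,
    fun a => ?_⟩
  · simp only [hc, Matrix.det_updateRow_add]
  · simp only [hc, Matrix.det_updateRow_smul, smul_eq_mul]
  · simp only [Matrix.det_updateRow_add]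
  · simp only [Matrix.det_updateRow_smul, smul_eq_mul]
  · refine Matrix.det_zero_of_row_eq h ?_
    rw [Matrix.updateRow_self, Matrix.updateRow_ne h, Matrix.updateRow_self]

/-- The recursion for cofactors obtained by removing the first edge of a walk. -/
theorem weightCofactor_eq_sum (p : E → ℝ) (u v : V) (hu : G.outFlow p u ≠ 0)
    (hdet : u = v → (G.weightMatrix p).det = 0) :
    G.weightCofactor p u v = ∑ e with G.src e = u,
      p e / G.outFlow p u * G.weightCofactor (p - Pi.single e 1) (G.tgt e) v := by
  set r : V → ℝ := ∑ f with G.src f = u, p f • (Pi.single (G.tgt f) 1 : V → ℝ) with hr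
  set d := G.outFlow p u with hd
  have hrow : G.weightMatrix p u = Pi.single u 1 - d⁻¹ • r := weightMatrix_row p u
  -- The row changed by removing `e` is the very row replaced in the cofactor. The sum is thus the
  -- determinant as a linear form in row `u`, taken at `d⁻¹ • r`, and the vanishing determinant
  -- equates this with its value at the unit vector.
  by_cases huv : u = v
  · subst huv
    have h1 : ∀ e ∈ Finset.univ.filter (fun e => G.src e = u),
        p e / d * G.weightCofactor (p - Pi.single e 1) (G.tgt e) u =
          d⁻¹ * Matrix.detRowAlternating.toMultilinearMap.toLinearMap (G.weightMatrix p) u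
            (p e • (Pi.single (G.tgt e) 1 : V → ℝ)) := by
      intro e he
      obtain rfl := (Finset.mem_filter.1 he).2
      rw [map_smul, weightCofactor, weightMatrix_sub_single]
      rw [Matrix.updateRow_idem, div_eq_inv_mul, mul_assoc]
      rfl
    rw [Finset.sum_congr rfl h1, ← Finset.mul_sum, ← map_sum, ← hr, ← smul_eq_mul, ← map_smul]
    have h2 : Matrix.detRowAlternating.toMultilinearMap.toLinearMap (G.weightMatrix p) u
        (G.weightMatrix p u) = 0 := by
      rw [← hdet rfl]
      change ((G.weightMatrix p).updateRow u (G.weightMatrix p u)).det = _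
      rw [Matrix.updateRow_eq_self]
    rw [hrow, map_sub, sub_eq_zero] at h2
    rw [← h2]; rfl
  -- The determinant is alternating in rows `u` and `v`. Every term with `(d - 1)⁻¹` cancels, either
  -- for each edge or after summing to `B r r = 0`, so the case `d = 1` needs no separate treatment.
  · obtain ⟨B, hB, hB0⟩ := exists_bilin_det_updateRow (G.weightMatrix p) huv
    have hanti : ∀ a b, B a b = -B b a := by
      intro a b
      have := hB0 (a + b)
      simp only [map_add, LinearMap.add_apply, hB0] at this
      linarith
    have h1 : ∀ e ∈ Finset.univ.filter (fun e => G.src e = u),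
        p e / d * G.weightCofactor (p - Pi.single e 1) (G.tgt e) v =
          d⁻¹ * B (Pi.single u 1 - (d - 1)⁻¹ • r) (p e • (Pi.single (G.tgt e) 1 : V → ℝ)) := by
      intro e he
      obtain rfl := (Finset.mem_filter.1 he).2
      have h3 : G.weightCofactor (p - Pi.single e 1) (G.tgt e) v =
          B (Pi.single (G.src e) 1 - (d - 1)⁻¹ • (r - Pi.single (G.tgt e) 1))
            (Pi.single (G.tgt e) 1) := by
        rw [hB, weightCofactor, weightMatrix_sub_single]
      rw [h3]
      simp only [map_sub, map_smul, LinearMap.sub_apply, LinearMap.smul_apply, hB0, smul_eq_mul]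
      ring
    have h4 : G.weightCofactor p u v = B (G.weightMatrix p u) (Pi.single u 1) := by
      rw [hB, weightCofactor, Matrix.updateRow_eq_self]
    rw [Finset.sum_congr rfl h1, ← Finset.mul_sum, ← map_sum, ← hr, h4, hrow]
    simp only [map_sub, map_smul, LinearMap.sub_apply, LinearMap.smul_apply, hB0, smul_eq_mul]
    rw [hanti r]; ring

omit [DecidableEq E] in
-- The rows of a stochastic matrix sum to 1, so the constant vector would be in the kernel. A vertex
-- without out-flow has a unit vector as its row, so the kernel vector must vanish there; balance
-- ensures that no used edge enters such a vertex.
theorem weightMatrix_det_eq_zero {m : E → ℕ} {u : V} (hm : G.IsBalanced m u u)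
    (hne : ∃ e, m e ≠ 0) : (G.weightMatrix fun e => (m e : ℝ)).det = 0 := by
  obtain ⟨e₀, he₀⟩ := hne
  have hpos : ∀ e, m e ≠ 0 → G.outFlow m (G.src e) ≠ 0 := fun e he => by
    have : m e ≤ G.outFlow m (G.src e) :=
      Finset.single_le_sum (f := m) (fun _ _ => Nat.zero_le _) (by simp)
    omega
  have hpos' : ∀ e, m e ≠ 0 → G.outFlow m (G.tgt e) ≠ 0 := fun e he => by
    have h1 : m e ≤ G.inFlow m (G.tgt e) :=
      Finset.single_le_sum (f := m) (fun _ _ => Nat.zero_le _) (by simp)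
    have := hm (G.tgt e)
    omega
  refine Matrix.exists_mulVec_eq_zero_iff.1
    ⟨fun i => if G.outFlow m i = 0 then 0 else 1, fun h => ?_, ?_⟩
  · have := congrFun h (G.src e₀)
    simp [hpos e₀ he₀] at this
  · ext i
    rw [weightMatrix_mulVec]
    have hcast : G.outFlow (fun e => (m e : ℝ)) i = ((G.outFlow m i : ℕ) : ℝ) := by
      simp [outFlow]
    have : ∀ e ∈ Finset.univ.filter (fun e => G.src e = i),
        (m e : ℝ) * (if G.outFlow m (G.tgt e) = 0 then (0 : ℝ) else 1) = m e := by
      intro e _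
      by_cases he : m e = 0
      · simp [he]
      · simp [hpos' e he]
    rw [Finset.sum_congr rfl this]
    change _ - _ * G.outFlow (fun e => (m e : ℝ)) i = _
    rw [hcast]
    by_cases hi : G.outFlow m i = 0
    · simp [hi]
    · have : ((G.outFlow m i : ℕ) : ℝ) ≠ 0 := by exact_mod_cast hi
      simp [hi, this]

omit [DecidableEq E] in
theorem weightCofactor_zero (u v : V) :
    G.weightCofactor (fun _ => 0) u v = if u = v then 1 else 0 := by
  have : G.weightMatrix (fun _ => 0) = 1 := by
    ext i j; simp [weightMatrix, Matrix.one_apply]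
  rw [weightCofactor, this, ← Matrix.adjugate_apply, Matrix.adjugate_one, Matrix.one_apply]

end WeightMatrix

/-! ### Whittle's formula, the maximum principle and Euler's theorem. -/

section Whittle

variable {V E A : Type*} [Fintype E] [DecidableEq E] {G : LabeledGraph V E A}

theorem typedWalks_eq_biUnion [DecidableEq V] (m : E → ℕ) (hm : ∃ e, m e ≠ 0)
    (u v : V) :
    G.typedWalks m u v = ⋃ e ∈ (Finset.univ.filter fun e => G.src e = u ∧ m e ≠ 0 : Finset E),
      List.cons e '' G.typedWalks (m - Pi.single e 1) (G.tgt e) v := by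
  ext w
  simp only [Finset.mem_filter, Finset.mem_univ, true_and, Set.mem_iUnion, Set.mem_image,
    exists_prop]
  constructor
  · rintro ⟨hw, hc⟩
    cases w with
    | nil => obtain ⟨e, he⟩ := hm; simp [← hc e] at he
    | cons e w =>
      refine ⟨e, ⟨hw.1, by rw [← hc e]; simp⟩, w, ⟨hw.2, fun f => ?_⟩, rfl⟩
      have := hc f
      rw [List.count_cons] at this
      by_cases hf : f = e
      · subst hf; simp at this ⊢; omega
      · simp only [Pi.sub_apply, Pi.single_eq_of_ne hf]
        simpa [Ne.symm hf] using this
  · rintro ⟨e, ⟨he, hme⟩, w, ⟨hw, hc⟩, rfl⟩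
    refine ⟨⟨he, hw⟩, fun f => ?_⟩
    rw [List.count_cons, hc]
    by_cases hf : f = e
    · subst hf; simp; omega
    · simp [hf, Ne.symm hf]

variable [DecidableEq V]

theorem ncard_typedWalks_eq_sum (m : E → ℕ) (hm : ∃ e, m e ≠ 0) (u v : V) :
    (G.typedWalks m u v).ncard = ∑ e with G.src e = u ∧ m e ≠ 0,
      (G.typedWalks (m - Pi.single e 1) (G.tgt e) v).ncard := by
  rw [typedWalks_eq_biUnion m hm]
  have hinj : ∀ e : E, Function.Injective (List.cons e) := fun e _ _ h => (List.cons.inj h).2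
  have := Set.Finite.ncard_biUnion
    (Finset.finite_toSet (Finset.univ.filter fun e => G.src e = u ∧ m e ≠ 0 : Finset E))
    (s := fun e => List.cons e '' G.typedWalks (m - Pi.single e 1) (G.tgt e) v)
    (fun e _ => (typedWalks_finite _ _ _).image _) ?_
  · simp only [Finset.mem_coe] at this
    rw [this, finsum_mem_finset_eq_sum]
    exact Finset.sum_congr rfl fun e _ => Set.ncard_image_of_injective _ (hinj e)
  · rintro e - f - hef
    refine Set.disjoint_left.2 ?_
    rintro _ ⟨w, -, rfl⟩ ⟨w', -, h⟩
    exact hef (List.cons.inj h).1.symm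

theorem isBalanced_sub_single {m : E → ℕ} {u v : V} (h : G.IsBalanced m u v) {e : E}
    (he : m e ≠ 0) (hu : G.src e = u) : G.IsBalanced (m - Pi.single e 1) (G.tgt e) v := by
  have hm : m = (m - Pi.single e 1) + Pi.single e 1 := by
    funext f
    by_cases hf : f = e
    · subst hf; simp; omega
    · simp [hf]
  intro i
  have := h i
  rw [hm] at this
  simp only [outFlow, inFlow, Pi.add_apply, Finset.sum_add_distrib, Pi.single_apply,
    Finset.sum_ite_eq', Finset.mem_filter, Finset.mem_univ, true_and] at this ⊢
  rw [hu] at this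
  simp only [eq_comm (a := i)] at this ⊢
  omega

omit [DecidableEq E] in
theorem IsBalanced.outFlow_ne_zero {m : E → ℕ} {u v : V} (h : G.IsBalanced m u v)
    (huv : u ≠ v) : G.outFlow m u ≠ 0 := by
  have := h u
  simp [huv] at this
  omega

/-- **Whittle's formula** for the number of walks with prescribed edge counts. -/
theorem ncard_typedWalks_eq [Fintype V] {m : E → ℕ} {u v : V} (h : G.IsBalanced m u v) :
    ((G.typedWalks m u v).ncard : ℝ) =
      (∏ i, ((G.outFlow m i).factorial : ℝ)) / (∏ e, ((m e).factorial : ℝ)) *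
        G.weightCofactor (fun e => (m e : ℝ)) u v := by
  induction hk : ∑ e, m e generalizing m u with
  | zero =>
    obtain rfl : m = fun _ => 0 := by
      funext e; exact (Finset.sum_eq_zero_iff.1 hk) e (Finset.mem_univ e)
    have : u = v := by
      by_contra huv
      exact h.outFlow_ne_zero huv (by simp [outFlow])
    subst this
    have h1 : G.typedWalks (fun _ => 0) u u = {[]} := by
      ext w
      simp only [typedWalks, Set.mem_ofPred_eq, Set.mem_singleton_iff]
      constructor
      · rintro ⟨-, hw⟩
        exact List.eq_nil_iff_forall_not_mem.2 fun e he => List.count_eq_zero.1 (hw e) he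
      · rintro rfl; simp [IsWalk]
    rw [h1]
    simp [weightCofactor_zero, outFlow]
  | succ k ih =>
    have hne : ∃ e, m e ≠ 0 := by
      by_contra! hall
      simp [hall] at hk
    rw [ncard_typedWalks_eq_sum m hne]
    -- Without out-flow at `u` there is no nonempty walk, and balance forces `u = v`. Row `u` is
    -- then already the unit vector, so the cofactor is the vanishing determinant and both sides are
    -- 0.
    by_cases hu : G.outFlow m u = 0
    · have h0 : ∀ e, G.src e = u → m e = 0 := fun e he =>
        Finset.sum_eq_zero_iff.1 hu e (by simp [he])
      have huv : u = v := by
        by_contra huv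
        exact h.outFlow_ne_zero huv hu
      subst huv
      have h1 : G.weightCofactor (fun e => (m e : ℝ)) u u = 0 := by
        have h2 : G.weightMatrix (fun e => (m e : ℝ)) u = Pi.single u 1 := by
          have h3 : G.outFlow (fun e => (m e : ℝ)) u = ((G.outFlow m u : ℕ) : ℝ) := by
            simp [outFlow]
          rw [weightMatrix_row, h3, hu]
          simp
        rw [weightCofactor, ← h2, Matrix.updateRow_eq_self]
        exact weightMatrix_det_eq_zero h hne
      rw [h1, mul_zero, Nat.cast_eq_zero]
      refine Finset.sum_eq_zero fun e he => ?_
      obtain ⟨-, he, he'⟩ := Finset.mem_filter.1 he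
      exact absurd (h0 e he) he'
    · have hd : G.outFlow (fun e => (m e : ℝ)) u = ((G.outFlow m u : ℕ) : ℝ) := by
        simp [outFlow]
      rw [weightCofactor_eq_sum _ _ _ (by rw [hd]; exact_mod_cast hu)
        (by rintro rfl; exact weightMatrix_det_eq_zero h hne), Finset.mul_sum, Nat.cast_sum,
        ← Finset.filter_filter, Finset.sum_filter]
      refine Finset.sum_congr rfl fun e he => ?_
      obtain rfl := (Finset.mem_filter.1 he).2
      -- Edges of count 0 have coefficient 0 in the recursion, so truncated subtraction is used only
      -- where it is exact.
      split_ifs with hme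
      · have hcast : (fun f => (((m - Pi.single e 1 : E → ℕ) f : ℕ) : ℝ)) =
            (fun f => (m f : ℝ)) - Pi.single e 1 := by
          funext f
          by_cases hf : f = e
          · subst hf
            simp [Nat.cast_sub (Nat.one_le_iff_ne_zero.2 hme)]
          · simp [hf]
        have hflow : G.outFlow (m - Pi.single e 1) = G.outFlow m - Pi.single (G.src e) 1 := by
          have hm : m = (m - Pi.single e 1) + Pi.single e 1 := by
            funext f
            by_cases hf : f = e
            · subst hf; simp; omega
            · simp [hf]
          funext i
          conv_rhs => rw [hm]
          simp only [outFlow, Pi.add_apply, Finset.sum_add_distrib, Pi.single_apply,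
            Finset.sum_ite_eq', Finset.mem_filter, Finset.mem_univ, true_and, Pi.sub_apply]
          simp only [eq_comm (a := i)]
          omega
        have hsum : ∑ f, (m - Pi.single e 1 : E → ℕ) f = k := by
          have h5 : ∀ f, m f = (m - Pi.single e 1 : E → ℕ) f + (Pi.single e 1 : E → ℕ) f := by
            intro f
            by_cases hf : f = e
            · subst hf; simp; omega
            · simp [hf]
          rw [Finset.sum_congr rfl fun f _ => h5 f, Finset.sum_add_distrib] at hk
          simpa using hk
        rw [ih (isBalanced_sub_single h hme rfl) hsum, hcast, hd, hflow]
        have h6 := Finset.prod_factorial_eq_mul m (Nat.pos_of_ne_zero hme)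
        have h7 := Finset.prod_factorial_eq_mul (G.outFlow m) (Nat.pos_of_ne_zero hu)
        have h6' := congrArg (Nat.cast (R := ℝ)) h6
        have h7' := congrArg (Nat.cast (R := ℝ)) h7
        push_cast at h6' h7'
        rw [h6', h7']
        have hme' : (m e : ℝ) ≠ 0 := by exact_mod_cast hme
        have hu' : ((G.outFlow m (G.src e) : ℕ) : ℝ) ≠ 0 := by exact_mod_cast hu
        have h8 : (∏ f, (((m - Pi.single e 1 : E → ℕ) f).factorial : ℝ)) ≠ 0 :=
          Finset.prod_ne_zero_iff.2 fun f _ => by positivity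
        field_simp
      · simp [not_not.1 hme]

omit [DecidableEq E] in
/-- A function that is harmonic off `v` is maximal at `v`. -/
theorem le_of_harmonic [Finite V] (hG : ∀ i j, ∃ w, G.IsWalk i w j) {p : E → ℝ}
    (hp : ∀ e, 0 < p e) {v : V} {x : V → ℝ}
    (hx : ∀ i, i ≠ v → ∑ e with G.src e = i, p e * (x i - x (G.tgt e)) = 0) (i : V) :
    x i ≤ x v := by
  have : Nonempty V := ⟨v⟩
  obtain ⟨j, hj⟩ := Finite.exists_max x
  -- Where a positively weighted average equals the maximum, all its entries do; the maximal value
  -- therefore travels along a walk from `j` until that walk meets `v`.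
  suffices h : ∀ w k, G.IsWalk k w v → x k = x j → x v = x j by
    obtain ⟨w, hw⟩ := hG j v
    rw [h w j hw rfl]; exact hj i
  intro w
  induction w with
  | nil => rintro k rfl h; exact h
  | cons e w ih =>
    rintro k ⟨rfl, hw⟩ h
    by_cases hk : G.src e = v
    · rw [← hk, h]
    · refine ih _ hw ?_
      have h0 := (Finset.sum_eq_zero_iff_of_nonneg fun f _ => mul_nonneg (hp f).le
        (by rw [h]; exact sub_nonneg.2 (hj _))).1 (hx _ hk) e (by simp)
      have := (mul_eq_zero.1 h0).resolve_left (hp e).ne'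
      linarith

omit [DecidableEq E] in
-- A kernel vector `x` of the modified matrix has `x u = 0` by the replaced row and is harmonic off
-- `v` by the others. Applied to `x` and `-x`, the maximum principle makes it constant, hence 0.
theorem weightCofactor_ne_zero [Fintype V] (hG : ∀ i j, ∃ w, G.IsWalk i w j) {p : E → ℝ}
    (hp : ∀ e, 0 < p e) (hout : ∀ i, G.outFlow p i ≠ 0) (u v : V) :
    G.weightCofactor p u v ≠ 0 := by
  intro h0
  obtain ⟨x, hx0, hx⟩ := Matrix.exists_mulVec_eq_zero_iff.2 h0
  have hxu : x u = 0 := by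
    have := congrFun hx v
    rw [Matrix.mulVec, Matrix.updateRow_self] at this
    simpa using this
  have hharm : ∀ i, i ≠ v → ∑ e with G.src e = i, p e * (x i - x (G.tgt e)) = 0 := by
    intro i hi
    have h1 := congrFun hx i
    rw [Matrix.mulVec, Matrix.updateRow_ne hi] at h1
    have h2 := weightMatrix_mulVec (G := G) p x i
    rw [Matrix.mulVec, h1] at h2
    simp only [mul_sub, Finset.sum_sub_distrib, ← Finset.sum_mul]
    change G.outFlow p i * x i - _ = 0
    have := hout i
    have h3 : x i = (G.outFlow p i)⁻¹ * ∑ e with G.src e = i, p e * x (G.tgt e) := by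
      simp only [Pi.zero_apply] at h2; linarith
    rw [sub_eq_zero, h3, mul_inv_cancel_left₀ this]
  have h1 := le_of_harmonic hG hp hharm
  have h2 := le_of_harmonic hG hp (x := -x) (v := v) fun i hi => by
    have := hharm i hi
    rw [← neg_eq_zero, ← Finset.sum_neg_distrib] at this
    rw [← this]
    exact Finset.sum_congr rfl fun e _ => by simp; ring
  refine hx0 (funext fun i => ?_)
  have h3 := h1 i
  have h4 := h2 i
  have h5 := h1 u
  have h6 := h2 u
  simp only [Pi.neg_apply, Pi.zero_apply] at *
  linarith

/-- **Euler's theorem** for directed multigraphs, with walks between two vertices. -/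
theorem typedWalks_nonempty [Fintype V] (hG : ∀ i j, ∃ w, G.IsWalk i w j)
    (hout : ∀ i, ∃ e, G.src e = i) {m : E → ℕ} (hm : ∀ e, 0 < m e) {u v : V}
    (h : G.IsBalanced m u v) : (G.typedWalks m u v).Nonempty := by
  -- Existence is read off from the count: no factor in Whittle's formula vanishes.
  rw [← Set.ncard_pos (typedWalks_finite m u v), Nat.pos_iff_ne_zero, ← Nat.cast_ne_zero (R := ℝ),
    ncard_typedWalks_eq h]
  refine mul_ne_zero (div_ne_zero ?_ ?_) ?_
  · exact Finset.prod_ne_zero_iff.2 fun f _ => by positivity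
  · exact Finset.prod_ne_zero_iff.2 fun f _ => by positivity
  · refine weightCofactor_ne_zero hG (fun e => by exact_mod_cast hm e) (fun i => ?_) u v
    obtain ⟨e, he⟩ := hout i
    exact (Finset.sum_pos (fun f _ => by exact_mod_cast hm f) ⟨e, by simp [he]⟩).ne'

end Whittle
end LabeledGraph

/-! ### Robbins' bounds for factorials. -/

namespace Stirling

/-- The difference of logarithms is the series of (2n+3)^(-2k)/(2k+1) over k ≥ 1. Since 2k+1 ≤ 3^k,
it dominates a geometric series with sum 1/(3(2n+3)² - 1), which exceeds the telescoping difference.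
-/
theorem le_log_stirlingSeq_sdiff (n : ℕ) :
    1 / (12 * ((n : ℝ) + 1) + 1) - 1 / (12 * ((n : ℝ) + 1 + 1) + 1) ≤
      Real.log (stirlingSeq (n + 1)) - Real.log (stirlingSeq (n + 2)) := by
  set r : ℝ := (1 / (2 * ((n + 1 : ℕ) : ℝ) + 1)) ^ 2 / 3 with hr
  have hn : (0 : ℝ) ≤ n := n.cast_nonneg
  have hr' : r = 1 / (3 * (2 * (n : ℝ) + 3) ^ 2) := by
    rw [hr]; push_cast; field_simp; ring
  have hr0 : 0 ≤ r := by rw [hr']; positivity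
  have hr1 : r < 1 := by
    rw [hr', div_lt_one (by positivity)]
    nlinarith
  have h1 : HasSum (fun k : ℕ => r ^ (k + 1)) ((1 - r)⁻¹ * r) := by
    simpa only [pow_succ] using (hasSum_geometric_of_lt_one hr0 hr1).mul_right r
  refine le_trans ?_ (hasSum_le (fun k => ?_) h1 (log_stirlingSeq_sdiff_hasSum n))
  · have h2 : (1 - r)⁻¹ * r = 1 / (3 * (2 * (n : ℝ) + 3) ^ 2 - 1) := by
      have h3 : (3 * (2 * (n : ℝ) + 3) ^ 2 - 1) ≠ 0 := by nlinarith
      have h4 : (3 * (2 * (n : ℝ) + 3) ^ 2) ≠ 0 := by positivity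
      rw [hr', one_sub_div h4]
      field_simp
    rw [h2, div_sub_div _ _ (by positivity) (by positivity),
      div_le_div_iff₀ (by positivity) (by nlinarith)]
    nlinarith
  · have h5 : (1 : ℝ) + ((k + 1 : ℕ) : ℝ) * 2 ≤ (1 + 2) ^ (k + 1) :=
      one_add_mul_le_pow (by norm_num) (k + 1)
    rw [hr, div_pow, div_eq_inv_mul, ← one_div]
    gcongr
    have h6 : (1 : ℝ) + 2 = 3 := by norm_num
    rw [h6] at h5
    linarith

theorem tendsto_log_stirlingSeq_succ_sub {c : ℕ → ℝ} (hc : Tendsto c atTop (𝓝 0)) :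
    Tendsto (fun n : ℕ => Real.log (stirlingSeq (n + 1)) - c n) atTop
      (𝓝 (Real.log Real.pi / 2)) := by
  have h1 := ((Real.continuousAt_log (Real.sqrt_pos.2 Real.pi_pos).ne').tendsto.comp
    tendsto_stirlingSeq_sqrt_pi).comp (tendsto_add_atTop_nat 1)
  simpa [Real.log_sqrt Real.pi_pos.le] using h1.sub hc

theorem tendsto_one_div_linear {a b : ℝ} (ha : 0 < a) :
    Tendsto (fun n : ℕ => 1 / (a * ((n : ℝ) + 1) + b)) atTop (𝓝 0) := by
  simp only [one_div]
  refine tendsto_inv_atTop_zero.comp (tendsto_atTop_add_const_right _ _ ?_)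
  exact (tendsto_atTop_add_const_right _ _ tendsto_natCast_atTop_atTop).const_mul_atTop ha

theorem log_factorial_eq {n : ℕ} (hn : n ≠ 0) :
    Real.log n.factorial = n * Real.log n - n + Real.log (2 * Real.pi * n) / 2 +
      (Real.log (stirlingSeq n) - Real.log Real.pi / 2) := by
  have hn' : (n : ℝ) ≠ 0 := by exact_mod_cast hn
  rw [log_stirlingSeq_formula, Real.log_div hn' (Real.exp_pos 1).ne', Real.log_exp,
    Real.log_mul (by positivity) hn', Real.log_mul two_ne_zero Real.pi_pos.ne',
    Real.log_mul two_ne_zero hn']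
  ring

/-- **Robbins' upper bound** for the factorial. -/
theorem log_factorial_le {n : ℕ} (hn : n ≠ 0) :
    Real.log n.factorial ≤
      n * Real.log n - n + Real.log (2 * Real.pi * n) / 2 + 1 / (12 * n) := by
  obtain ⟨n, rfl⟩ := Nat.exists_eq_succ_of_ne_zero hn
  -- Once corrected by 1/(12n), the sequence increases to its limit and so stays below it. The `+ 0`
  -- fits the common form of the two corrections, the lower bound using `+ 1`.
  have hmono : Monotone fun n : ℕ =>
      Real.log (stirlingSeq (n + 1)) - 1 / (12 * ((n : ℝ) + 1) + 0) := by
    refine monotone_nat_of_le_succ fun n => ?_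
    have := log_stirlingSeq_sdiff_le (n + 1)
    push_cast at this ⊢
    have h1 : 1 / (12 * ((n : ℝ) + 1) * (n + 1 + 1)) =
        1 / (12 * ((n : ℝ) + 1) + 0) - 1 / (12 * ((n : ℝ) + 1 + 1) + 0) := by
      field_simp; ring
    linarith
  have := hmono.ge_of_tendsto
    (tendsto_log_stirlingSeq_succ_sub (tendsto_one_div_linear (by norm_num))) n
  rw [log_factorial_eq hn]
  simp only [add_zero, Nat.succ_eq_add_one] at this ⊢
  push_cast
  linarith

/-- **Robbins' lower bound** for the factorial. -/
theorem le_log_factorial {n : ℕ} (hn : n ≠ 0) :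
    n * Real.log n - n + Real.log (2 * Real.pi * n) / 2 + 1 / (12 * n + 1) ≤
      Real.log n.factorial := by
  obtain ⟨n, rfl⟩ := Nat.exists_eq_succ_of_ne_zero hn
  have hanti : Antitone fun n : ℕ =>
      Real.log (stirlingSeq (n + 1)) - 1 / (12 * ((n : ℝ) + 1) + 1) := by
    refine antitone_nat_of_succ_le fun n => ?_
    have := le_log_stirlingSeq_sdiff n
    push_cast at this ⊢
    linarith
  have := hanti.le_of_tendsto
    (tendsto_log_stirlingSeq_succ_sub (tendsto_one_div_linear (by norm_num))) n
  rw [log_factorial_eq hn]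
  simp only [Nat.succ_eq_add_one] at this ⊢
  push_cast
  linarith

end Stirling

/-! ### Integral chains and their multiplicities. -/

namespace LabeledGraph

/-- Scale invariance lets the cofactor of the counts `m P(e)` be replaced by that of the
probabilities. -/
theorem weightMatrix_const_mul {V E A : Type*} [DecidableEq V] [Fintype E]
    {G : LabeledGraph V E A} {c : ℝ} (hc : c ≠ 0) (p : E → ℝ) :
    G.weightMatrix (fun e => c * p e) = G.weightMatrix p := by
  ext i j
  simp only [weightMatrix, outFlow, ← Finset.mul_sum, Matrix.of_apply, mul_div_mul_left _ _ hc]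

end LabeledGraph

namespace EdgeChain

open LabeledGraph

variable {V E A : Type*} [DecidableEq V] [Fintype E] {G : LabeledGraph V E A} {P : EdgeChain E}

theorem vertexProb_nonneg (P : EdgeChain E) (G : LabeledGraph V E A) (u : V) :
    0 ≤ P.vertexProb G u := Finset.sum_nonneg fun e _ => P.nonneg e

theorem prob_le_vertexProb (P : EdgeChain E) (G : LabeledGraph V E A) (e : E) :
    P.prob e ≤ P.vertexProb G (G.src e) :=
  Finset.single_le_sum (f := P.prob) (fun e _ => P.nonneg e) (by simp)

theorem vertexProb_pos (hprim : G.IsPrimitive) (hP : P.IsPositive) (u : V) :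
    0 < P.vertexProb G u := by
  obtain ⟨e, rfl⟩ := hprim.exists_src_eq u
  exact (hP e).trans_le (P.prob_le_vertexProb G e)

theorem sum_vertexProb [Fintype V] (P : EdgeChain E) (G : LabeledGraph V E A) :
    ∑ u, P.vertexProb G u = 1 :=
  (sum_outFlow (G := G) P.prob).trans P.sum_eq_one

theorem pMin_le (P : EdgeChain E) (e : E) : P.pMin ≤ P.prob e :=
  ciInf_le (Set.finite_range _).bddBelow e

theorem whittleCofactor_eq [Fintype V] (P : EdgeChain E) (G : LabeledGraph V E A) (u v : V) :
    P.whittleCofactor G v u = G.weightCofactor P.prob u v :=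
  Matrix.adjugate_apply _ _ _

omit [DecidableEq V] in
theorem cast_multiplicity {n : ℕ} (h : P.IsIntegral n) (e : E) :
    (P.multiplicity n e : ℝ) = n * P.prob e := by
  obtain ⟨k, hk⟩ := h e
  rw [multiplicity, hk, Nat.floor_natCast]

theorem cast_outFlow_multiplicity {n : ℕ} (h : P.IsIntegral n) (u : V) :
    ((G.outFlow (P.multiplicity n) u : ℕ) : ℝ) = n * P.vertexProb G u := by
  rw [outFlow, Nat.cast_sum, vertexProb, Finset.mul_sum]
  exact Finset.sum_congr rfl fun e _ => cast_multiplicity h e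

theorem cast_inFlow_multiplicity {n : ℕ} (h : P.IsIntegral n) (u : V) :
    ((G.inFlow (P.multiplicity n) u : ℕ) : ℝ) = n * G.inFlow P.prob u := by
  rw [inFlow, Nat.cast_sum, inFlow, Finset.mul_sum]
  exact Finset.sum_congr rfl fun e _ => cast_multiplicity h e

theorem isBalanced_multiplicity {n : ℕ} (hP : P.IsStationary G) (h : P.IsIntegral n) (u : V) :
    G.IsBalanced (P.multiplicity n) u u := by
  intro i
  congr 1
  have := hP i
  rw [← Nat.cast_inj (R := ℝ), cast_outFlow_multiplicity h, cast_inFlow_multiplicity h, this]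
  rfl

omit [DecidableEq V] in
theorem multiplicity_pos {n : ℕ} (hP : P.IsPositive) (h : P.IsIntegral n) (hn : 1 ≤ n) (e : E) :
    0 < P.multiplicity n e := by
  have h1 := cast_multiplicity h e
  have h2 : (0 : ℝ) < n * P.prob e := mul_pos (by exact_mod_cast hn) (hP e)
  rw [← h1] at h2
  exact_mod_cast h2

omit [DecidableEq V] in
theorem sum_multiplicity {n : ℕ} (h : P.IsIntegral n) : ∑ e, P.multiplicity n e = n := by
  rw [← Nat.cast_inj (R := ℝ), Nat.cast_sum, Finset.sum_congr rfl fun e _ => cast_multiplicity h e,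
    ← Finset.mul_sum, P.sum_eq_one, mul_one]

end EdgeChain

/-! ### The codebook: existence of completions, exact constraints and size. -/

section Pool

open LabeledGraph

variable {V E A : Type*} [Fintype E] [LinearOrder E] {G : LabeledGraph V E A} {P : EdgeChain E}
  {root : V} {n : ℕ} {α ζ : ℝ} {w : List E}

theorem admissiblePrefixes_finite : (admissiblePrefixes G P root α ζ n).Finite :=
  (List.finite_length_eq E (headLength α n)).subset fun _ h => h.2.1

/-- The range of ζ is chosen so that P(e) + ζ < P(e)/α, and n' ≤ αn. If n' = 0 the typicality
quotient is 0/0 = 0 and carries no information, but `w` is then empty. -/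
theorem count_lt_of_mem_admissiblePrefixes (hP : P.IsPositive) (hn : 1 ≤ n) (hα : 0 < α)
    (hα1 : α < 1) (hζ : IsTypicality P α ζ) (hw : w ∈ admissiblePrefixes G P root α ζ n) (e : E) :
    (w.count e : ℝ) < n * P.prob e := by
  obtain ⟨-, hl, hc⟩ := hw
  have hn' : (0 : ℝ) < n := by exact_mod_cast hn
  rcases Nat.eq_zero_or_pos (headLength α n) with h0 | h0
  · obtain rfl := List.length_eq_zero_iff.1 (hl.trans h0)
    simpa using mul_pos hn' (hP e)
  · have h1 : (0 : ℝ) < headLength α n := by exact_mod_cast h0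
    have h2 : (headLength α n : ℝ) ≤ α * n := Nat.floor_le (by positivity)
    have h3 := (abs_lt.1 (hc e)).2
    have h4 : ζ < (1 - α) / α * P.prob e :=
      hζ.2.trans_le (mul_le_mul_of_nonneg_left (P.pMin_le e)
        (div_nonneg (by linarith) hα.le))
    have h5 : (w.count e : ℝ) / headLength α n < P.prob e / α := by
      have : P.prob e / α = P.prob e + (1 - α) / α * P.prob e := by field_simp; ring
      linarith
    rw [div_lt_div_iff₀ h1 hα] at h5
    have h6 : P.prob e * headLength α n ≤ P.prob e * (α * n) :=
      mul_le_mul_of_nonneg_left h2 (hP e).le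
    nlinarith

variable [DecidableEq V] [Fintype V]

omit [DecidableEq V] [Fintype V] in
theorem residualMult_pos (hP : P.IsPositive) (hn : 1 ≤ n) (hi : P.IsIntegral n) (hα : 0 < α)
    (hα1 : α < 1) (hζ : IsTypicality P α ζ) (hw : w ∈ admissiblePrefixes G P root α ζ n) (e : E) :
    w.count e + residualMult P n w e = P.multiplicity n e ∧ 0 < residualMult P n w e := by
  have h1 := count_lt_of_mem_admissiblePrefixes hP hn hα hα1 hζ hw e
  rw [← EdgeChain.cast_multiplicity hi, Nat.cast_lt] at h1
  unfold residualMult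
  omega

omit [Fintype V] in
-- The multiplicities `n P(e)` form a circulation, so subtracting the counts of `w` reverses its
-- divergence.
theorem isBalanced_residualMult (hS : P.IsStationary G) (hP : P.IsPositive) (hn : 1 ≤ n)
    (hi : P.IsIntegral n) (hα : 0 < α)
    (hα1 : α < 1) (hζ : IsTypicality P α ζ) (hw : w ∈ admissiblePrefixes G P root α ζ n) :
    G.IsBalanced (residualMult P n w) (G.endVertex root w) root := by
  intro i
  obtain ⟨v, hv⟩ := hw.1
  have h1 := hv.isBalanced i
  have h2 := EdgeChain.isBalanced_multiplicity hS hi root i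
  have h3 : P.multiplicity n = fun e => w.count e + residualMult P n w e :=
    funext fun e => (residualMult_pos hP hn hi hα hα1 hζ hw e).1.symm
  rw [h3] at h2
  rw [hv.endVertex_eq]
  simp only [outFlow, inFlow, Finset.sum_add_distrib] at h1 h2 ⊢
  omega

theorem isLeast_firstCompletion (hprim : G.IsPrimitive) (hS : P.IsStationary G)
    (hP : P.IsPositive) (hn : 1 ≤ n) (hi : P.IsIntegral n) (hα : 0 < α)
    (hα1 : α < 1) (hζ : IsTypicality P α ζ) (hw : w ∈ admissiblePrefixes G P root α ζ n) :
    IsLeast (completions G P root n w) (firstCompletion G P root n w) := by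
  have hne : (completions G P root n w).Nonempty := by
    obtain ⟨x, hx⟩ := typedWalks_nonempty hprim.exists_isWalk hprim.exists_src_eq
      (fun e => (residualMult_pos hP hn hi hα hα1 hζ hw e).2)
      (isBalanced_residualMult hS hP hn hi hα hα1 hζ hw)
    exact ⟨x, mem_completions_iff.2 hx⟩
  have hfin : (completions G P root n w).Finite :=
    (typedWalks_finite _ _ _).subset fun x hx => mem_completions_iff.1 hx
  have h : ∃ x, IsLeast (completions G P root n w) x := by
    obtain ⟨x, hx, hmin⟩ := Set.exists_min_image _ id hfin hne
    exact ⟨x, hx, fun y hy => hmin y hy⟩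
  rw [firstCompletion, dif_pos h]
  exact h.choose_spec

theorem append_firstCompletion_mem (hprim : G.IsPrimitive) (hS : P.IsStationary G)
    (hP : P.IsPositive) (hn : 1 ≤ n) (hi : P.IsIntegral n) (hα : 0 < α)
    (hα1 : α < 1) (hζ : IsTypicality P α ζ) (hw : w ∈ admissiblePrefixes G P root α ζ n) :
    w ++ firstCompletion G P root n w ∈ G.typedWalks (P.multiplicity n) root root := by
  have h := mem_completions_iff.1 (isLeast_firstCompletion hprim hS hP hn hi hα hα1 hζ hw).1
  obtain ⟨v, hv⟩ := hw.1
  refine ⟨isWalk_append.2 ⟨v, hv, hv.endVertex_eq ▸ h.1⟩, fun e => ?_⟩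
  rw [List.count_append, h.2]
  exact (residualMult_pos hP hn hi hα hα1 hζ hw e).1

/-- The label determines the full walk from the root, and cutting it at the common length n' returns
`w`; the choice of completion plays no role in injectivity. -/
theorem ncard_pool (hdet : G.IsDeterministic) (hprim : G.IsPrimitive) (hS : P.IsStationary G)
    (hP : P.IsPositive) (hn : 1 ≤ n) (hi : P.IsIntegral n) (hα : 0 < α)
    (hα1 : α < 1) (hζ : IsTypicality P α ζ) :
    (pool G P root α ζ n).ncard = (admissiblePrefixes G P root α ζ n).ncard := by
  refine Set.InjOn.ncard_image fun w hw w' hw' h => ?_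
  have h1 := append_firstCompletion_mem hprim hS hP hn hi hα hα1 hζ hw
  have h2 := append_firstCompletion_mem hprim hS hP hn hi hα hα1 hζ hw'
  have h3 := h1.1.word_injective hdet h2.1 h
  exact (List.append_inj h3 (hw.2.1.trans hw'.2.1.symm)).1

theorem pool_subset (hprim : G.IsPrimitive) (hS : P.IsStationary G)
    (hP : P.IsPositive) (hn : 1 ≤ n) (hi : P.IsIntegral n) (hα : 0 < α)
    (hα1 : α < 1) (hζ : IsTypicality P α ζ) :
    (∀ c ∈ pool G P root α ζ n, c.length = n) ∧
      pool G P root α ζ n ⊆ P.eulerCodebook G n ∧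
      pool G P root α ζ n ⊆
        G.weaklyConstrainedSystem LabeledGraph.edgeIndicator P.prob (fun _ => 0) := by
  have hlen : ∀ x ∈ G.typedWalks (P.multiplicity n) root root, x.length = n := fun x hx =>
    (typedWalks_length hx).trans (EdgeChain.sum_multiplicity hi)
  refine ⟨?_, ?_, ?_⟩
  · rintro _ ⟨w, hw, rfl⟩
    simpa [word] using hlen _ (append_firstCompletion_mem hprim hS hP hn hi hα hα1 hζ hw)
  · rintro _ ⟨w, hw, rfl⟩
    exact mem_eulerCodebook_iff.2
      ⟨root, _, append_firstCompletion_mem hprim hS hP hn hi hα hα1 hζ hw, rfl⟩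
  · rintro _ ⟨w, hw, rfl⟩
    have h := append_firstCompletion_mem hprim hS hP hn hi hα hα1 hζ hw
    refine ⟨⟨root, _, root, h.1, rfl⟩, root, _, root, h.1, rfl, fun s => ?_⟩
    have h1 : ∑ e, empirical (w ++ firstCompletion G P root n w) e * edgeIndicator e s =
        empirical (w ++ firstCompletion G P root n w) s := by
      rw [Finset.sum_eq_single s]
      · simp [edgeIndicator]
      · intro e _ he; simp [edgeIndicator, he.symm]
      · simp
    have hn' : (n : ℝ) ≠ 0 := by positivity
    rw [h1, empirical, hlen _ h, h.2, EdgeChain.cast_multiplicity hi]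
    field_simp
    simp

end Pool

/-! ### Walks whose edge frequencies are exactly those of a chain. -/

section ExactCount

open LabeledGraph

variable {V E A : Type*} [Fintype E] [LinearOrder E] [DecidableEq V] {G : LabeledGraph V E A}
  {P : EdgeChain E} {root : V} {m : ℕ}

omit [DecidableEq V] in
theorem exactCount_eq (hi : P.IsIntegral m) (u v : V) :
    exactCount G P u v m = (G.typedWalks (P.multiplicity m) u v).ncard := by
  unfold exactCount
  congr 1
  ext w
  simp only [Set.mem_ofPred_eq, typedWalks]
  constructor
  · rintro ⟨h1, h2, h3⟩
    refine ⟨h1, fun e => ?_⟩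
    rw [← Nat.cast_inj (R := ℝ), h3, EdgeChain.cast_multiplicity hi]
  · rintro ⟨h1, h2⟩
    refine ⟨h1, ?_, fun e => by rw [h2, EdgeChain.cast_multiplicity hi]⟩
    rw [typedWalks_length (G := G) ⟨h1, h2⟩, EdgeChain.sum_multiplicity hi]

theorem exactCount_eq_zero (hS : P.IsStationary G) (hi : P.IsIntegral m) {u v : V} (h : v ≠ u) :
    exactCount G P u v m = 0 := by
  rw [exactCount_eq hi]
  have : G.typedWalks (P.multiplicity m) u v = ∅ := by
    refine Set.eq_empty_of_forall_notMem fun w hw => ?_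
    have h1 := hw.1.isBalanced u
    have h2 := EdgeChain.isBalanced_multiplicity hS hi u u
    rw [funext hw.2] at h1
    simp [h.symm] at h1 h2
    omega
  rw [this, Set.ncard_empty]

variable [Fintype V]

theorem exactCount_root_eq (hS : P.IsStationary G) (hi : P.IsIntegral m) (hm : 1 ≤ m) (u : V) :
    (exactCount G P u u m : ℝ) =
        (∏ i, (⌊(m : ℝ) * P.vertexProb G i⌋₊.factorial : ℝ)) /
          (∏ e, (⌊(m : ℝ) * P.prob e⌋₊.factorial : ℝ)) * P.whittleCofactor G u u := by
  have hm' : (m : ℝ) ≠ 0 := by positivity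
  have h1 : ∀ i, ⌊(m : ℝ) * P.vertexProb G i⌋₊ = G.outFlow (P.multiplicity m) i := fun i => by
    rw [← EdgeChain.cast_outFlow_multiplicity hi, Nat.floor_natCast]
  rw [exactCount_eq hi, ncard_typedWalks_eq (EdgeChain.isBalanced_multiplicity hS hi u),
    EdgeChain.whittleCofactor_eq]
  simp only [h1, EdgeChain.cast_multiplicity hi]
  congr 1
  rw [weightCofactor, weightMatrix_const_mul hm', ← weightCofactor]

theorem exactCount_pos (hprim : G.IsPrimitive) (hS : P.IsStationary G) (hP : P.IsPositive)
    (hi : P.IsIntegral m) (hm : 1 ≤ m) (u : V) : 0 < exactCount G P u u m := by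
  rw [exactCount_eq hi]
  exact (Set.ncard_pos (typedWalks_finite _ _ _)).2
    (typedWalks_nonempty hprim.exists_isWalk hprim.exists_src_eq
      (EdgeChain.multiplicity_pos hP hi hm) (EdgeChain.isBalanced_multiplicity hS hi u))

/-- The cofactor times a positive quotient of factorials is a positive count, so its sign needs no
matrix argument. -/
theorem whittleCofactor_pos (hprim : G.IsPrimitive) (hS : P.IsStationary G) (hP : P.IsPositive)
    (hi : P.IsIntegral m) (hm : 1 ≤ m) (u : V) : 0 < P.whittleCofactor G u u := by
  have h1 : (0 : ℝ) < exactCount G P u u m := by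
    exact_mod_cast exactCount_pos hprim hS hP hi hm u
  rw [exactCount_root_eq hS hi hm] at h1
  exact pos_of_mul_pos_right h1 (by positivity)

omit [DecidableEq V] [Fintype V] in
-- A second chain `Q` is allowed because `P` is integral for n but perhaps not for n'; the tolerance
-- absorbs the difference.
theorem exactCount_le_ncard_admissiblePrefixes {Q : EdgeChain E} {n : ℕ} {α ζ : ℝ}
    (hn' : 1 ≤ headLength α n) (hQ : ∀ e, |Q.prob e - P.prob e| < ζ) :
    exactCount G Q root root (headLength α n) ≤ (admissiblePrefixes G P root α ζ n).ncard := by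
  refine Set.ncard_le_ncard ?_ admissiblePrefixes_finite
  rintro w ⟨h1, h2, h3⟩
  refine ⟨⟨_, h1⟩, h2, fun e => ?_⟩
  have : (headLength α n : ℝ) ≠ 0 := by positivity
  rw [h3, mul_div_cancel_left₀ _ this]
  exact hQ e

end ExactCount

section

open LabeledGraph

theorem logb_two_mul_log_two (x : ℝ) : Real.logb 2 x * Real.log 2 = Real.log x :=
  div_mul_cancel₀ _ (Real.log_pos one_lt_two).ne'

/-! ### From Whittle's formula to the entropy exponent. -/

section Entropy

variable {V E A : Type*} [Fintype V] [DecidableEq V] [Fintype E]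

namespace EdgeChain

theorem sum_prob_mul_src (P : EdgeChain E) (G : LabeledGraph V E A) (f : V → ℝ) :
    ∑ e, P.prob e * f (G.src e) = ∑ u, P.vertexProb G u * f u := by
  rw [← Finset.sum_fiberwise Finset.univ G.src]
  refine Finset.sum_congr rfl fun u _ => ?_
  rw [vertexProb, Finset.sum_mul]
  exact Finset.sum_congr rfl fun e he => by rw [(Finset.mem_filter.1 he).2]

/-- This form has no quotient and is continuous even where probabilities vanish, as the limits and
the compactness argument require. -/
theorem entropyRate_mul_log_two (P : EdgeChain E) (G : LabeledGraph V E A) :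
    P.entropyRate G * Real.log 2 =
      ∑ e, Real.negMulLog (P.prob e) - ∑ u, Real.negMulLog (P.vertexProb G u) := by
  have h : ∀ e, P.prob e * Real.logb 2 (P.prob e / P.vertexProb G (G.src e)) * Real.log 2 =
      P.prob e * Real.log (P.prob e) - P.prob e * Real.log (P.vertexProb G (G.src e)) := by
    intro e
    rw [mul_assoc, logb_two_mul_log_two]
    rcases (P.nonneg e).eq_or_lt with h0 | h0
    · simp [← h0]
    · rw [Real.log_div h0.ne' (h0.trans_le (P.prob_le_vertexProb G e)).ne']
      ring
  rw [entropyRate, neg_mul, Finset.sum_mul, Finset.sum_congr rfl fun e _ => h e,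
    Finset.sum_sub_distrib, P.sum_prob_mul_src G fun u => Real.log (P.vertexProb G u)]
  simp only [Real.negMulLog, neg_mul, Finset.sum_neg_distrib]
  ring

end EdgeChain

variable [LinearOrder E] {G : LabeledGraph V E A} {P : EdgeChain E} {m : ℕ}

omit [LinearOrder E] in
-- The right side is made of Robbins' bounds, lower for vertices and upper for edges. The
-- contributions of m log m - m cancel because vertex and edge masses both sum to 1.
theorem poolExponent_mul_log_two (P : EdgeChain E) (hP : P.IsPositive) (hprim : G.IsPrimitive)
    (hm : 1 ≤ m) (root : V) :
    poolExponent G P root m * Real.log 2 =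
      (∑ i, (m * P.vertexProb G i * Real.log (m * P.vertexProb G i) - m * P.vertexProb G i +
        Real.log (2 * Real.pi * (m * P.vertexProb G i)) / 2 +
        1 / (12 * (m * P.vertexProb G i) + 1))) -
      (∑ e, (m * P.prob e * Real.log (m * P.prob e) - m * P.prob e +
        Real.log (2 * Real.pi * (m * P.prob e)) / 2 + 1 / (12 * (m * P.prob e)))) +
      Real.log (P.whittleCofactor G root root) := by
  have hm' : (m : ℝ) ≠ 0 := by positivity
  have h2 : (2 * Real.pi * m : ℝ) ≠ 0 := by positivity
  have hterm : ∀ x c : ℝ, 0 < x → m * x * Real.log (m * x) - m * x +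
      Real.log (2 * Real.pi * (m * x)) / 2 + c = x * (m * Real.log m - m) - m * Real.negMulLog x +
        Real.log (2 * Real.pi * m) / 2 + Real.log x / 2 + c := by
    intro x c hx
    rw [← mul_assoc (2 * Real.pi), Real.log_mul h2 hx.ne', Real.log_mul hm' hx.ne', Real.negMulLog]
    ring
  rw [Finset.sum_congr rfl fun i _ => hterm _ _ (EdgeChain.vertexProb_pos hprim hP i),
    Finset.sum_congr rfl fun e _ => hterm _ _ (hP e)]
  simp only [Finset.sum_add_distrib, Finset.sum_sub_distrib, ← Finset.sum_mul, ← Finset.mul_sum,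
    ← Finset.sum_div, P.sum_vertexProb G, P.sum_eq_one, Finset.sum_const, Finset.card_univ,
    nsmul_eq_mul, ← mul_assoc]
  have hH := P.entropyRate_mul_log_two G
  have he : Real.logb 2 (Real.exp 1) * Real.log 2 = 1 := by
    rw [logb_two_mul_log_two, Real.log_exp]
  have hl := logb_two_mul_log_two
  have hlV : (∑ u, Real.logb 2 (P.vertexProb G u)) * Real.log 2 =
      ∑ u, Real.log (P.vertexProb G u) := by
    rw [Finset.sum_mul]; exact Finset.sum_congr rfl fun u _ => hl _
  have hlE : (∑ e, Real.logb 2 (P.prob e)) * Real.log 2 = ∑ e, Real.log (P.prob e) := by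
    rw [Finset.sum_mul]; exact Finset.sum_congr rfl fun u _ => hl _
  have hlm := hl (2 * Real.pi * m)
  have hlc := hl (P.whittleCofactor G root root)
  rw [poolExponent, stirlingDelta, poolConstant]
  linear_combination (m : ℝ) * hH +
    (((Fintype.card V : ℝ) - (Fintype.card E : ℝ)) / 2) * hlm + hlc + 1 / 2 * hlV - 1 / 2 * hlE +
    ((∑ i, 1 / (12 * (m : ℝ) * P.vertexProb G i + 1)) - ∑ e, 1 / (12 * (m : ℝ) * P.prob e)) * he

theorem poolExponent_le_logb_exactCount (hprim : G.IsPrimitive) (hS : P.IsStationary G)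
    (hP : P.IsPositive) (hi : P.IsIntegral m) (hm : 1 ≤ m) (root : V) :
    poolExponent G P root m ≤ Real.logb 2 (exactCount G P root root m) := by
  have hlog2 : 0 < Real.log 2 := Real.log_pos one_lt_two
  rw [← mul_le_mul_iff_left₀ hlog2, logb_two_mul_log_two, poolExponent_mul_log_two P hP hprim hm,
    exactCount_root_eq hS hi hm]
  have hF := whittleCofactor_pos hprim hS hP hi hm root
  have hm' : (0 : ℝ) < m := by exact_mod_cast hm
  rw [Real.log_mul (by positivity) hF.ne', Real.log_div (by positivity) (by positivity),
    Real.log_prod (fun i _ => by positivity), Real.log_prod (fun i _ => by positivity)]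
  refine add_le_add_left (sub_le_sub (Finset.sum_le_sum fun i _ => ?_)
    (Finset.sum_le_sum fun e _ => ?_)) _
  · have h1 : ((⌊(m : ℝ) * P.vertexProb G i⌋₊ : ℕ) : ℝ) = m * P.vertexProb G i := by
      rw [← EdgeChain.cast_outFlow_multiplicity hi, Nat.floor_natCast]
    have h2 := Stirling.le_log_factorial (n := ⌊(m : ℝ) * P.vertexProb G i⌋₊) (by
      rw [← Nat.cast_ne_zero (R := ℝ), h1]
      exact (mul_pos hm' (EdgeChain.vertexProb_pos hprim hP i)).ne')
    rwa [h1] at h2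
  · have h1 : ((⌊(m : ℝ) * P.prob e⌋₊ : ℕ) : ℝ) = m * P.prob e :=
      EdgeChain.cast_multiplicity hi e
    have h2 := Stirling.log_factorial_le (n := ⌊(m : ℝ) * P.prob e⌋₊) (by
      rw [← Nat.cast_ne_zero (R := ℝ), h1]
      exact (mul_pos hm' (hP e)).ne')
    rwa [h1] at h2

theorem two_rpow_poolExponent_le (hprim : G.IsPrimitive) (hS : P.IsStationary G)
    (hP : P.IsPositive) (hi : P.IsIntegral m) (hm : 1 ≤ m) (root : V) :
    (2 : ℝ) ^ poolExponent G P root m ≤ exactCount G P root root m :=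
  (Real.le_logb_iff_rpow_le one_lt_two (by exact_mod_cast exactCount_pos hprim hS hP hi hm root)).1
    (poolExponent_le_logb_exactCount hprim hS hP hi hm root)

end Entropy

/-! ### Rounding stationary chains to integral ones. -/

section Rounding

variable {V E A : Type*} [Fintype V] [DecidableEq V] [Fintype E] {G : LabeledGraph V E A}

namespace LabeledGraph

omit [Fintype V] in
theorem outFlow_add_mul (f g : E → ℤ) (c : ℤ) (u : V) :
    G.outFlow (fun e => f e + c * g e) u = G.outFlow f u + c * G.outFlow g u := by
  simp [outFlow, Finset.sum_add_distrib, Finset.mul_sum]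

omit [Fintype V] in
theorem inFlow_add_mul (f g : E → ℤ) (c : ℤ) (u : V) :
    G.inFlow (fun e => f e + c * g e) u = G.inFlow f u + c * G.inFlow g u := by
  simp [inFlow, Finset.sum_add_distrib, Finset.mul_sum]

omit [Fintype V] in
theorem outFlow_sum_mul {ι : Type*} (s : Finset ι) (b : ι → ℤ) (g : ι → E → ℤ) (u : V) :
    G.outFlow (fun e => ∑ i ∈ s, b i * g i e) u = ∑ i ∈ s, b i * G.outFlow (g i) u := by
  simp only [outFlow, Finset.mul_sum]; exact Finset.sum_comm

omit [Fintype V] in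
theorem inFlow_sum_mul {ι : Type*} (s : Finset ι) (b : ι → ℤ) (g : ι → E → ℤ) (u : V) :
    G.inFlow (fun e => ∑ i ∈ s, b i * g i e) u = ∑ i ∈ s, b i * G.inFlow (g i) u := by
  simp only [inFlow, Finset.mul_sum]; exact Finset.sum_comm

/-- An integral edge weighting becomes a circulation after adding walks from a root to each
vertex, weighted by the divergence there. -/
theorem outFlow_eq_inFlow_add_sum {root : V} {r : V → E → ℤ}
    (hr : ∀ v i, G.outFlow (r v) i + (if i = v then 1 else 0) =
      G.inFlow (r v) i + (if i = root then 1 else 0)) (x : E → ℤ) (u : V) :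
    G.outFlow (fun e => x e + 1 * ∑ v, (G.outFlow x v - G.inFlow x v) * r v e) u =
      G.inFlow (fun e => x e + 1 * ∑ v, (G.outFlow x v - G.inFlow x v) * r v e) u := by
  rw [outFlow_add_mul, inFlow_add_mul, outFlow_sum_mul, inFlow_sum_mul]
  have h1 : ∀ v, (G.outFlow x v - G.inFlow x v) * G.outFlow (r v) u =
      (G.outFlow x v - G.inFlow x v) * G.inFlow (r v) u +
        (G.outFlow x v - G.inFlow x v) * (if u = root then 1 else 0) -
        (G.outFlow x v - G.inFlow x v) * (if u = v then 1 else 0) := by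
    intro v
    have := hr v u
    linear_combination (G.outFlow x v - G.inFlow x v) * this
  rw [Finset.sum_congr rfl fun v _ => h1 v, Finset.sum_sub_distrib, Finset.sum_add_distrib,
    ← Finset.sum_mul, Finset.sum_sub_distrib, sum_outFlow, sum_inFlow]
  simp
  ring

/-- Every stationary chain, scaled by `n`, is within a bounded distance of an integral circulation
of total weight `n`. -/
theorem exists_integral_circulation (hprim : G.IsPrimitive) (root : V) :
    ∃ C : ℝ, 0 ≤ C ∧ ∀ (P : EdgeChain E) (n : ℕ), P.IsStationary G →
      ∃ y : E → ℤ, (∀ u, G.outFlow y u = G.inFlow y u) ∧ ∑ e, y e = n ∧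
        ∀ e, |(y e : ℝ) - n * P.prob e| ≤ C := by
  classical
  choose w hw using fun v => hprim.exists_isWalk root v
  obtain ⟨N, hN, hwalk⟩ := hprim
  -- Closed walks of lengths `N` and `N + 1` differ by a circulation `d` of total weight 1, which
  -- later adjusts the total without disturbing balance.
  obtain ⟨c₀, hc₀, hl₀⟩ := hwalk root root
  obtain ⟨c₁, hc₁, hl₁⟩ : ∃ c, G.IsWalk root c root ∧ c.length = N + 1 := by
    obtain ⟨e, he⟩ : ∃ e, G.src e = root := IsPrimitive.exists_src_eq ⟨N, hN, hwalk⟩ root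
    obtain ⟨c, hc, hl⟩ := hwalk (G.tgt e) root
    exact ⟨e :: c, ⟨he, hc⟩, by simp [hl]⟩
  set r : V → E → ℤ := fun v e => (w v).count e with hr
  set d : E → ℤ := fun e => (c₁.count e : ℤ) - c₀.count e with hd
  have hrbal : ∀ v i, G.outFlow (r v) i + (if i = v then 1 else 0) =
      G.inFlow (r v) i + (if i = root then 1 else 0) := by
    intro v i
    have := (hw v).isBalanced i
    simp only [outFlow, inFlow, hr] at this ⊢
    exact_mod_cast this
  have hdbal : ∀ i, G.outFlow d i = G.inFlow d i := by
    intro i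
    have h0 := hc₀.isBalanced i
    have h1 := hc₁.isBalanced i
    simp only [outFlow, inFlow, hd, Finset.sum_sub_distrib, ← Nat.cast_sum] at h0 h1 ⊢
    omega
  have hdsum : ∑ e, d e = 1 := by
    simp only [hd, Finset.sum_sub_distrib, ← Nat.cast_sum, sum_count_eq_length, hl₀, hl₁]
    push_cast; ring
  obtain ⟨cE, hcE⟩ : ∃ cE : ℝ, cE = Fintype.card E := ⟨_, rfl⟩
  obtain ⟨K, hK⟩ : ∃ K : ℝ, K = ∑ v, ∑ e, |(r v e : ℝ)| := ⟨_, rfl⟩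
  obtain ⟨D, hD⟩ : ∃ D : ℝ, D = ∑ e, |(d e : ℝ)| := ⟨_, rfl⟩
  have hcE0 : 0 ≤ cE := by rw [hcE]; positivity
  have hK0 : 0 ≤ K := by rw [hK]; positivity
  have hD0 : 0 ≤ D := by rw [hD]; positivity
  obtain ⟨B, hB⟩ : ∃ B : ℝ, B = 1 + 2 * cE * K := ⟨_, rfl⟩
  have hB0 : 0 ≤ B := by rw [hB]; positivity
  refine ⟨B + cE * B * D, by positivity, fun P n hP => ?_⟩
  set x : E → ℤ := fun e => ⌊(n : ℝ) * P.prob e⌋ with hx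
  have hx1 : ∀ e, |(x e : ℝ) - n * P.prob e| ≤ 1 := by
    intro e
    rw [abs_le]
    have h1 := Int.floor_le ((n : ℝ) * P.prob e)
    have h2 := Int.lt_floor_add_one ((n : ℝ) * P.prob e)
    constructor <;> simp only [hx] <;> linarith
  set b : V → ℤ := fun v => G.outFlow x v - G.inFlow x v with hb
  have hsumle : ∀ (s : Finset E) (f : E → ℝ) (c : ℝ), 0 ≤ c → (∀ e, |f e| ≤ c) →
      |∑ e ∈ s, f e| ≤ cE * c := by
    intro s f c hc hf
    refine (Finset.abs_sum_le_sum_abs _ _).trans ?_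
    refine (Finset.sum_le_card_nsmul s _ c fun e _ => hf e).trans ?_
    rw [nsmul_eq_mul]
    exact mul_le_mul_of_nonneg_right (by rw [hcE]; exact_mod_cast Finset.card_le_univ s) hc
  -- By stationarity `n P` has no divergence, so that of its floor comes from rounding errors alone
  -- and is bounded independently of `n`.
  have hb1 : ∀ v, |(b v : ℝ)| ≤ 2 * cE := by
    intro v
    have hst : ∑ e with G.src e = v, (n : ℝ) * P.prob e =
        ∑ e with G.tgt e = v, (n : ℝ) * P.prob e := by
      rw [← Finset.mul_sum, ← Finset.mul_sum]; exact congrArg _ (hP v)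
    have h1 : (b v : ℝ) = ∑ e with G.src e = v, ((x e : ℝ) - n * P.prob e) -
        ∑ e with G.tgt e = v, ((x e : ℝ) - n * P.prob e) := by
      rw [Finset.sum_sub_distrib, Finset.sum_sub_distrib, hst]
      simp only [hb, outFlow, inFlow]
      push_cast; ring
    have h2 := hsumle (Finset.univ.filter fun e => G.src e = v) _ 1 zero_le_one hx1
    have h3 := hsumle (Finset.univ.filter fun e => G.tgt e = v) _ 1 zero_le_one hx1
    rw [h1]
    refine (abs_sub _ _).trans ?_
    linarith
  -- Here the divergence is repaired by walks from the root; the total is off by the bounded integer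
  -- `t`, corrected by `t * d`.
  set z : E → ℤ := fun e => x e + 1 * ∑ v, b v * r v e with hz
  have hz1 : ∀ e, |(z e : ℝ) - n * P.prob e| ≤ B := by
    intro e
    have h1 : (z e : ℝ) - n * P.prob e = ((x e : ℝ) - n * P.prob e) + ∑ v, (b v : ℝ) * r v e := by
      simp only [hz]; push_cast; ring
    rw [h1, hB]
    refine (abs_add_le _ _).trans (add_le_add (hx1 e) ?_)
    refine (Finset.abs_sum_le_sum_abs _ _).trans ?_
    rw [hK, Finset.mul_sum]
    refine Finset.sum_le_sum fun v _ => ?_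
    rw [abs_mul]
    exact mul_le_mul (hb1 v)
      (Finset.single_le_sum (f := fun e => |(r v e : ℝ)|) (fun _ _ => abs_nonneg _)
        (Finset.mem_univ e)) (abs_nonneg _) (by positivity)
  set t : ℤ := n - ∑ e, z e with ht
  have ht1 : |(t : ℝ)| ≤ cE * B := by
    have h1 : (t : ℝ) = -∑ e, ((z e : ℝ) - n * P.prob e) := by
      rw [Finset.sum_sub_distrib, ← Finset.mul_sum, P.sum_eq_one, ht]; push_cast; ring
    rw [h1, abs_neg]
    exact hsumle _ _ _ (by positivity) hz1
  refine ⟨fun e => z e + t * d e, fun u => ?_, ?_, fun e => ?_⟩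
  · rw [outFlow_add_mul, inFlow_add_mul, hdbal, outFlow_eq_inFlow_add_sum hrbal]
  · rw [Finset.sum_add_distrib, ← Finset.mul_sum, hdsum, ht]; ring
  · have h1 : (((z e + t * d e : ℤ)) : ℝ) - n * P.prob e =
        ((z e : ℝ) - n * P.prob e) + t * d e := by push_cast; ring
    rw [h1]
    refine (abs_add_le _ _).trans (add_le_add (hz1 e) ?_)
    rw [abs_mul]
    rw [hD]
    exact mul_le_mul ht1 (Finset.single_le_sum (f := fun e => |(d e : ℝ)|)
      (fun _ _ => abs_nonneg _) (Finset.mem_univ e)) (abs_nonneg _) (by positivity)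

end LabeledGraph

namespace EdgeChain

/-- The chain with edge probabilities `y e / n`. -/
noncomputable def ofCounts (y : E → ℕ) (n : ℕ) (hn : n ≠ 0) (hy : ∑ e, y e = n) : EdgeChain E where
  prob e := y e / n
  nonneg e := by positivity
  sum_eq_one := by
    rw [← Finset.sum_div, ← Nat.cast_sum, hy]
    exact div_self (by exact_mod_cast hn)

theorem ofCounts_isIntegral (y : E → ℕ) (n : ℕ) (hn : n ≠ 0) (hy : ∑ e, y e = n) :
    (ofCounts y n hn hy).IsIntegral n := fun e => ⟨y e, by
  have : (n : ℝ) ≠ 0 := by exact_mod_cast hn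
  simp only [ofCounts]; field_simp⟩

omit [Fintype V] in
theorem ofCounts_isStationary (y : E → ℕ) (n : ℕ) (hn : n ≠ 0) (hy : ∑ e, y e = n)
    (h : ∀ u, G.outFlow y u = G.inFlow y u) : (ofCounts y n hn hy).IsStationary G := by
  intro u
  simp only [vertexProb, ofCounts, ← Finset.sum_div, ← Nat.cast_sum]
  exact congrArg (fun k : ℕ => (k : ℝ) / n) (h u)

/-- A stationary chain with large `n P(e)` has a close stationary positive `n`-integral chain. -/
theorem exists_isIntegral_near (hprim : G.IsPrimitive) (root : V) :
    ∃ C : ℝ, 0 ≤ C ∧ ∀ (P : EdgeChain E) (n : ℕ), P.IsStationary G → 1 ≤ n →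
      (∀ e, C < n * P.prob e) → ∃ Q : EdgeChain E,
        Q.IsStationary G ∧ Q.IsPositive ∧ Q.IsIntegral n ∧
          ∀ e, |P.prob e - Q.prob e| ≤ C / (n : ℝ) := by
  obtain ⟨C, hC0, hC⟩ := exists_integral_circulation hprim root
  refine ⟨C, hC0, fun P n hP hn hlarge => ?_⟩
  obtain ⟨y, hy, hsum, hclose⟩ := hC P n hP
  have hn' : (0 : ℝ) < n := by exact_mod_cast hn
  have hpos : ∀ e, 0 < y e := fun e => by
    have h1 := (abs_le.1 (hclose e)).1
    have h2 := hlarge e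
    have : (0 : ℝ) < y e := by linarith
    exact_mod_cast this
  lift y to E → ℕ using fun e => (hpos e).le
  beta_reduce at hsum hpos hclose hy
  simp only [outFlow, inFlow] at hy
  have hsum' : ∑ e, y e = n := by exact_mod_cast hsum
  refine ⟨ofCounts y n (by omega) hsum', ofCounts_isStationary _ _ _ _ fun u => ?_, fun e => ?_,
    ofCounts_isIntegral _ _ _ _, fun e => ?_⟩
  · have := hy u; simp only [outFlow, inFlow]; exact_mod_cast this
  · have := hpos e
    exact div_pos (by exact_mod_cast this) hn'
  · have h1 := hclose e
    have h2 : P.prob e - (ofCounts y n (by omega) hsum').prob e =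
        -((((y e : ℕ) : ℤ) : ℝ) - n * P.prob e) / n := by
      simp only [ofCounts]; push_cast; field_simp; ring
    rw [h2, abs_div, abs_neg, abs_of_pos hn']
    exact div_le_div_of_nonneg_right h1 hn'.le

end EdgeChain

end Rounding

/-! ### Bounding the number of walks by their Markov probabilities. -/

namespace LabeledGraph

variable {V E A : Type*} [DecidableEq V] [Fintype E] [DecidableEq E]

/-- The finite set of walks of length `l` that start at `u`. -/
def walkFinset (G : LabeledGraph V E A) : ℕ → V → Finset (List E)
  | 0, _ => {[]}
  | l + 1, u => (Finset.univ.filter fun e => G.src e = u).biUnion fun e =>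
      (G.walkFinset l (G.tgt e)).image (List.cons e)

variable {G : LabeledGraph V E A}

theorem mem_walkFinset {l : ℕ} {u : V} {w : List E} :
    w ∈ G.walkFinset l u ↔ (∃ v, G.IsWalk u w v) ∧ w.length = l := by
  induction l generalizing u w with
  | zero =>
    simp only [walkFinset, Finset.mem_singleton, List.length_eq_zero_iff]
    constructor
    · rintro rfl; exact ⟨⟨u, rfl⟩, rfl⟩
    · exact fun h => h.2
  | succ l ih =>
    simp only [walkFinset, Finset.mem_biUnion, Finset.mem_filter, Finset.mem_univ, true_and,
      Finset.mem_image, ih]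
    constructor
    · rintro ⟨e, he, w, ⟨⟨v, hv⟩, hl⟩, rfl⟩
      exact ⟨⟨v, he, hv⟩, by simp [hl]⟩
    · rintro ⟨⟨v, hv⟩, hl⟩
      cases w with
      | nil => simp at hl
      | cons e w => exact ⟨e, hv.1, w, ⟨⟨v, hv.2⟩, by simpa using hl⟩, rfl⟩

/-- The product is the probability of the walk under the transition weights `q`; splitting off the
first edge gives the induction. -/
theorem sum_walkFinset_prod_le_one {q : E → ℝ} (hq : ∀ e, 0 ≤ q e)
    (hq1 : ∀ u, ∑ e with G.src e = u, q e ≤ 1) (l : ℕ) (u : V) :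
    ∑ w ∈ G.walkFinset l u, ∏ e, q e ^ w.count e ≤ 1 := by
  induction l generalizing u with
  | zero => simp [walkFinset]
  | succ l ih =>
    rw [walkFinset, Finset.sum_biUnion]
    · refine le_trans (Finset.sum_le_sum fun e _ => ?_) (hq1 u)
      rw [Finset.sum_image fun _ _ _ _ h => (List.cons.inj h).2]
      have : ∀ w : List E, ∏ f, q f ^ (e :: w).count f = q e * ∏ f, q f ^ w.count f := by
        intro w
        simp only [List.count_cons, pow_add, Finset.prod_mul_distrib, beq_iff_eq, pow_ite, pow_one,
          pow_zero, Finset.prod_ite_eq, Finset.mem_univ, if_true]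
        ring
      simp only [this, ← Finset.mul_sum]
      exact mul_le_of_le_one_right (hq e) (ih _)
    · rintro e - f - hef
      refine Finset.disjoint_left.2 fun w h1 h2 => ?_
      obtain ⟨w₁, -, rfl⟩ := Finset.mem_image.1 h1
      obtain ⟨w₂, -, h⟩ := Finset.mem_image.1 h2
      exact hef (List.cons.inj h).1.symm

/-- A set of equally long walks from `u`, each of probability at least `c`, has at most `1 / c`
elements. -/
theorem ncard_mul_le_one {q : E → ℝ} (hq : ∀ e, 0 ≤ q e)
    (hq1 : ∀ u, ∑ e with G.src e = u, q e ≤ 1) {l : ℕ} {u : V} {S : Set (List E)}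
    (hS : ∀ w ∈ S, (∃ v, G.IsWalk u w v) ∧ w.length = l) {c : ℝ}
    (hc : ∀ w ∈ S, c ≤ ∏ e, q e ^ w.count e) : (S.ncard : ℝ) * c ≤ 1 := by
  have hfin : S.Finite := (G.walkFinset l u).finite_toSet.subset fun w hw =>
    mem_walkFinset.2 (hS w hw)
  rw [Set.ncard_eq_toFinset_card S hfin, ← nsmul_eq_mul]
  refine (Finset.card_nsmul_le_sum _ _ c fun w hw => hc w (hfin.mem_toFinset.1 hw)).trans
    ((Finset.sum_le_sum_of_subset_of_nonneg (t := G.walkFinset l u) (fun w hw => ?_)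
      fun w _ _ => Finset.prod_nonneg fun e _ => pow_nonneg (hq e) _).trans
      (sum_walkFinset_prod_le_one hq hq1 l u))
  exact mem_walkFinset.2 (hS w (hfin.mem_toFinset.1 hw))

end LabeledGraph

/-! ### Transition probabilities and continuity in the chain. -/

namespace EdgeChain

variable {V E A : Type*} [DecidableEq V] [Fintype E] {G : LabeledGraph V E A}

/-- The transition probability `P(e) / π(σ(e))`. -/
noncomputable def transProb (P : EdgeChain E) (G : LabeledGraph V E A) (e : E) : ℝ :=
  P.prob e / P.vertexProb G (G.src e)

theorem transProb_nonneg (P : EdgeChain E) (e : E) : 0 ≤ P.transProb G e :=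
  div_nonneg (P.nonneg e) (P.vertexProb_nonneg G _)

theorem transProb_pos (P : EdgeChain E) {e : E} (he : 0 < P.prob e) : 0 < P.transProb G e :=
  div_pos he (he.trans_le (P.prob_le_vertexProb G e))

/-- Only an inequality holds: at a vertex of mass zero all transition probabilities are 0/0 = 0. -/
theorem sum_transProb_le_one (P : EdgeChain E) (u : V) :
    ∑ e with G.src e = u, P.transProb G e ≤ 1 := by
  have : ∀ e ∈ Finset.univ.filter (fun e => G.src e = u),
      P.transProb G e = P.prob e / P.vertexProb G u := fun e he => by
    rw [transProb, (Finset.mem_filter.1 he).2]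
  rw [Finset.sum_congr rfl this, ← Finset.sum_div]
  exact div_self_le_one _

theorem tendsto_vertexProb {Q : ℕ → EdgeChain E} {P : EdgeChain E}
    (h : ∀ e, Tendsto (fun k => (Q k).prob e) atTop (𝓝 (P.prob e))) (u : V) :
    Tendsto (fun k => (Q k).vertexProb G u) atTop (𝓝 (P.vertexProb G u)) :=
  tendsto_finsetSum _ fun e _ => h e

theorem tendsto_entropyRate [Fintype V] {Q : ℕ → EdgeChain E} {P : EdgeChain E}
    (h : ∀ e, Tendsto (fun k => (Q k).prob e) atTop (𝓝 (P.prob e))) :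
    Tendsto (fun k => (Q k).entropyRate G) atTop (𝓝 (P.entropyRate G)) := by
  have hl : Real.log 2 ≠ 0 := (Real.log_pos one_lt_two).ne'
  have h1 : ∀ P : EdgeChain E, P.entropyRate G =
      (∑ e, Real.negMulLog (P.prob e) - ∑ u, Real.negMulLog (P.vertexProb G u)) / Real.log 2 :=
    fun P => by rw [← P.entropyRate_mul_log_two G, mul_div_cancel_right₀ _ hl]
  simp only [h1]
  exact ((tendsto_finsetSum _ fun e _ => (Real.continuous_negMulLog.tendsto _).comp (h e)).sub
    (tendsto_finsetSum _ fun u _ => (Real.continuous_negMulLog.tendsto _).comp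
      (tendsto_vertexProb h u))).div_const _

theorem tendsto_whittleCofactor [Fintype V] {Q : ℕ → EdgeChain E} {P : EdgeChain E}
    (hpos : ∀ u, P.vertexProb G u ≠ 0)
    (h : ∀ e, Tendsto (fun k => (Q k).prob e) atTop (𝓝 (P.prob e))) (u v : V) :
    Tendsto (fun k => (Q k).whittleCofactor G u v) atTop (𝓝 (P.whittleCofactor G u v)) := by
  have h1 : Tendsto (fun k => (Q k).whittleMatrix G) atTop (𝓝 (P.whittleMatrix G)) := by
    refine tendsto_pi_nhds.2 fun i => tendsto_pi_nhds.2 fun j => ?_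
    exact tendsto_const_nhds.sub ((tendsto_finsetSum _ fun e _ => h e).div
      (tendsto_vertexProb h i) (hpos i))
  have h2 : Continuous fun M : Matrix V V ℝ => M.adjugate v u :=
    (continuous_id.matrix_adjugate).matrix_elem v u
  exact (h2.tendsto _).comp h1

theorem whittleCofactor_ne_zero [Fintype V] {P : EdgeChain E} (hprim : G.IsPrimitive)
    (hP : P.IsPositive) (u v : V) : P.whittleCofactor G u v ≠ 0 := by
  rw [whittleCofactor_eq]
  exact weightCofactor_ne_zero hprim.exists_isWalk hP
    (fun i => (vertexProb_pos hprim hP i).ne') _ _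

end EdgeChain

/-! ### The asymptotic rate of the pool. -/

section Rate

variable {V E A : Type*} [Fintype V] [DecidableEq V] [Fintype E] {G : LabeledGraph V E A}

theorem tendsto_logb_const_mul_div {m : ℕ → ℕ} (hm : Tendsto m atTop atTop) :
    Tendsto (fun k => Real.logb 2 (2 * Real.pi * (m k : ℝ)) / m k) atTop (𝓝 0) := by
  have hm' : Tendsto (fun k => (m k : ℝ)) atTop atTop := tendsto_natCast_atTop_atTop.comp hm
  have hp : (0 : ℝ) < 2 * Real.pi := by positivity
  have h1 : Tendsto (fun x : ℝ => Real.log x / x) atTop (𝓝 0) := by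
    simpa using Real.tendsto_pow_log_div_mul_add_atTop 1 0 1 one_ne_zero
  have h2 := ((h1.comp (hm'.const_mul_atTop hp)).mul_const (2 * Real.pi)).div_const (Real.log 2)
  simp only [zero_mul, zero_div] at h2
  refine h2.congr fun k => ?_
  simp only [Function.comp, Real.logb]
  rcases eq_or_ne (m k : ℝ) 0 with h | h
  · simp [h]
  · field_simp

/-- Only the entropy term has order m: the logarithm is o(m), the Stirling correction tends to 0,
and the constant converges because the limit chain is positive. -/
theorem tendsto_poolExponent_div (root : V) {P : EdgeChain E} {Q : ℕ → EdgeChain E} {m : ℕ → ℕ}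
    (hprim : G.IsPrimitive) (hP : P.IsPositive) (hm : Tendsto m atTop atTop)
    (h : ∀ e, Tendsto (fun k => (Q k).prob e) atTop (𝓝 (P.prob e))) :
    Tendsto (fun k => poolExponent G (Q k) root (m k) / (m k : ℝ)) atTop
      (𝓝 (P.entropyRate G)) := by
  have hm' : Tendsto (fun k => (m k : ℝ)) atTop atTop := tendsto_natCast_atTop_atTop.comp hm
  have hinv : ∀ (x : ℕ → ℝ) (a c : ℝ), 0 < a → Tendsto x atTop (𝓝 a) →
      Tendsto (fun k => 1 / (12 * (m k : ℝ) * x k + c)) atTop (𝓝 0) := by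
    intro x a c ha hx
    simp only [one_div]
    exact tendsto_inv_atTop_zero.comp (tendsto_atTop_add_const_right _ _
      ((hm'.const_mul_atTop (by norm_num)).atTop_mul_pos ha hx))
  have hlog : ∀ (x : ℕ → ℝ) (a : ℝ), a ≠ 0 → Tendsto x atTop (𝓝 a) →
      Tendsto (fun k => Real.logb 2 (x k)) atTop (𝓝 (Real.logb 2 a)) := by
    intro x a ha hx
    exact (hx.log ha).div_const _
  have hvpos := fun u => EdgeChain.vertexProb_pos hprim hP u
  have hΔ : Tendsto (fun k => stirlingDelta G (Q k) (m k)) atTop (𝓝 0) := by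
    have h1 : Tendsto (fun k => ∑ i, 1 / (12 * (m k : ℝ) * (Q k).vertexProb G i + 1)) atTop
        (𝓝 (∑ _i : V, 0)) :=
      tendsto_finsetSum _ fun i _ => hinv _ _ _ (hvpos i) (EdgeChain.tendsto_vertexProb h i)
    have h2 : Tendsto (fun k => ∑ e, 1 / (12 * (m k : ℝ) * (Q k).prob e)) atTop
        (𝓝 (∑ _e : E, 0)) :=
      tendsto_finsetSum _ fun e _ => by simpa using hinv _ _ 0 (hP e) (h e)
    simpa [stirlingDelta] using (h1.sub h2).const_mul (Real.logb 2 (Real.exp 1))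
  have hC : Tendsto (fun k => poolConstant G (Q k) root root) atTop
      (𝓝 (poolConstant G P root root)) :=
    (((tendsto_finsetSum _ fun u _ => hlog _ _ (hvpos u).ne'
      (EdgeChain.tendsto_vertexProb h u)).sub (tendsto_finsetSum _ fun e _ =>
      hlog _ _ (hP e).ne' (h e))).const_mul _).add
      (hlog _ _ (EdgeChain.whittleCofactor_ne_zero hprim hP root root)
        (EdgeChain.tendsto_whittleCofactor (fun u => (hvpos u).ne') h root root))
  have hlim := (((EdgeChain.tendsto_entropyRate (G := G) h).add
    ((tendsto_logb_const_mul_div hm).const_mul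
      (((Fintype.card V : ℝ) - (Fintype.card E : ℝ)) / 2))).add
    (hΔ.div_atTop hm')).add (hC.div_atTop hm')
  simp only [mul_zero, add_zero] at hlim
  refine hlim.congr' ?_
  filter_upwards [hm.eventually_ge_atTop 1] with k hk
  have : (m k : ℝ) ≠ 0 := by positivity
  rw [poolExponent]
  field_simp

theorem tendsto_headLength_div {N : ℕ → ℕ} (hN : Tendsto N atTop atTop) {α : ℝ} (hα : 0 < α) :
    Tendsto (fun k => (headLength α (N k) : ℝ) / N k) atTop (𝓝 α) :=
  (tendsto_nat_floor_mul_div_atTop hα.le).comp (tendsto_natCast_atTop_atTop.comp hN)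

theorem tendsto_headLength {N : ℕ → ℕ} (hN : Tendsto N atTop atTop) {α : ℝ} (hα : 0 < α) :
    Tendsto (fun k => headLength α (N k)) atTop atTop :=
  tendsto_nat_floor_atTop.comp
    ((tendsto_natCast_atTop_atTop.comp hN).const_mul_atTop hα)

/-- Integral approximation of a convergent sequence of stationary chains. -/
theorem EdgeChain.exists_seq_isIntegral_near (hprim : G.IsPrimitive) (root : V) {P : EdgeChain E}
    (hP : P.IsPositive) {Q : ℕ → EdgeChain E} (hQ : ∀ k, (Q k).IsStationary G)
    (h : ∀ e, Tendsto (fun k => (Q k).prob e) atTop (𝓝 (P.prob e))) {m : ℕ → ℕ}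
    (hm : Tendsto m atTop atTop) :
    ∃ (C : ℝ) (R : ℕ → EdgeChain E), (∀ᶠ k in atTop, 1 ≤ m k ∧ (R k).IsStationary G ∧
      (R k).IsPositive ∧ (R k).IsIntegral (m k) ∧
        ∀ e, |(Q k).prob e - (R k).prob e| ≤ C / (m k : ℝ)) ∧
      ∀ e, Tendsto (fun k => (R k).prob e) atTop (𝓝 (P.prob e)) := by
  obtain ⟨C, hC0, hC⟩ := EdgeChain.exists_isIntegral_near hprim root
  have hm' : Tendsto (fun k => (m k : ℝ)) atTop atTop := tendsto_natCast_atTop_atTop.comp hm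
  have hex : ∀ k, ∃ R : EdgeChain E, (1 ≤ m k ∧ ∀ e, C < m k * (Q k).prob e) →
      R.IsStationary G ∧ R.IsPositive ∧ R.IsIntegral (m k) ∧
        ∀ e, |(Q k).prob e - R.prob e| ≤ C / (m k : ℝ) := by
    intro k
    by_cases hk : 1 ≤ m k ∧ ∀ e, C < m k * (Q k).prob e
    · obtain ⟨R, hR⟩ := hC (Q k) (m k) (hQ k) hk.1 hk.2
      exact ⟨R, fun _ => hR⟩
    · exact ⟨Q k, fun h => absurd h hk⟩
  choose R hR using hex
  have hev : ∀ᶠ k in atTop, 1 ≤ m k ∧ ∀ e, C < m k * (Q k).prob e := by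
    refine (hm.eventually_ge_atTop 1).and (eventually_all.2 fun e => ?_)
    exact (hm'.atTop_mul_pos (hP e) (h e)).eventually_gt_atTop C
  refine ⟨C, R, hev.mono fun k hk => ⟨hk.1, hR k hk⟩, fun e => ?_⟩
  have h1 : Tendsto (fun k => (Q k).prob e - (R k).prob e) atTop (𝓝 0) := by
    refine squeeze_zero_norm' ?_ (tendsto_const_nhds.div_atTop hm' : Tendsto
      (fun k => C / (m k : ℝ)) atTop (𝓝 0))
    filter_upwards [hev] with k hk
    exact (hR k hk).2.2.2 e
  simpa using (h e).sub h1

variable [LinearOrder E]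

/-- The data of the asymptotic statements. -/
structure IsPoolSequence (G : LabeledGraph V E A) (P : EdgeChain E) (Q : ℕ → EdgeChain E)
    (N : ℕ → ℕ) (α : ℝ) (ζ : ℕ → ℝ) : Prop where
  tendsto_length : Tendsto N atTop atTop
  chain : ∀ k, (Q k).IsStationary G ∧ (Q k).IsPositive ∧ (Q k).IsIntegral (N k)
  tendsto_prob : ∀ e, Tendsto (fun k => (Q k).prob e) atTop (𝓝 (P.prob e))
  alpha_pos : 0 < α
  alpha_lt_one : α < 1
  typicality : ∀ k, IsTypicality (Q k) α (ζ k)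
  tendsto_mul : Tendsto (fun k => (N k : ℝ) * ζ k) atTop atTop

namespace IsPoolSequence

variable {P : EdgeChain E} {Q : ℕ → EdgeChain E} {N : ℕ → ℕ} {α : ℝ} {ζ : ℕ → ℝ}

omit [Fintype V] [LinearOrder E] in
theorem tendsto_headLength_mul (h : IsPoolSequence G P Q N α ζ) :
    Tendsto (fun k => (headLength α (N k) : ℝ) * ζ k) atTop atTop := by
  have h1 : Tendsto (fun k => (headLength α (N k) : ℝ) / N k * ((N k : ℝ) * ζ k)) atTop atTop :=
    (tendsto_headLength_div h.tendsto_length h.alpha_pos).pos_mul_atTop h.alpha_pos h.tendsto_mul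
  refine h1.congr' ?_
  filter_upwards [h.tendsto_length.eventually_ge_atTop 1] with k hk
  have : (N k : ℝ) ≠ 0 := by positivity
  field_simp

theorem poolRate_eq (h : IsPoolSequence G P Q N α ζ) (hdet : G.IsDeterministic)
    (hprim : G.IsPrimitive) (root : V) {k : ℕ} (hk : 1 ≤ N k) :
    poolRate G (Q k) root α (ζ k) (N k) = (headLength α (N k) : ℝ) / N k *
      (Real.logb 2 (admissiblePrefixes G (Q k) root α (ζ k) (N k)).ncard / headLength α (N k)) := by
  obtain ⟨h1, h2, h3⟩ := h.chain k
  rw [poolRate, ncard_pool hdet hprim h1 h2 hk h3 h.alpha_pos h.alpha_lt_one (h.typicality k)]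
  rcases eq_or_ne (headLength α (N k) : ℝ) 0 with h0 | h0
  -- For n' = 0 at most the empty prefix is admissible; the logarithm of 0 or 1 is 0, as is the
  -- division by 0 on the right.
  · have h4 : (admissiblePrefixes G (Q k) root α (ζ k) (N k)) ⊆ {[]} := fun w hw =>
      List.length_eq_zero_iff.1 (hw.2.1.trans (by exact_mod_cast h0))
    have h5 := Set.ncard_le_ncard h4
    rw [Set.ncard_singleton] at h5
    interval_cases (admissiblePrefixes G (Q k) root α (ζ k) (N k)).ncard <;> simp
  · have : (N k : ℝ) ≠ 0 := by positivity
    field_simp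

/-- The rates are asymptotically at least `α H(P)`; there are eventually admissible prefixes. -/
theorem exists_le_poolRate (h : IsPoolSequence G P Q N α ζ) (hP : P.IsPositive)
    (hdet : G.IsDeterministic) (hprim : G.IsPrimitive) (root : V) :
    (∃ g : ℕ → ℝ, Tendsto g atTop (𝓝 (α * P.entropyRate G)) ∧
      ∀ᶠ k in atTop, g k ≤ poolRate G (Q k) root α (ζ k) (N k)) ∧
    ∀ᶠ k in atTop, 0 < (admissiblePrefixes G (Q k) root α (ζ k) (N k)).ncard := by
  set m : ℕ → ℕ := fun k => headLength α (N k)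
  have hm : Tendsto m atTop atTop := tendsto_headLength h.tendsto_length h.alpha_pos
  obtain ⟨C, R, hev, hRlim⟩ := EdgeChain.exists_seq_isIntegral_near hprim root hP
    (fun k => (h.chain k).1) h.tendsto_prob hm
  have hcount : ∀ᶠ k in atTop, exactCount G (R k) root root (m k) ≤
      (admissiblePrefixes G (Q k) root α (ζ k) (N k)).ncard ∧
      0 < exactCount G (R k) root root (m k) ∧
      poolExponent G (R k) root (m k) ≤ Real.logb 2 (exactCount G (R k) root root (m k)) := by
    -- Once n' ζ > C, the rounding error C/n' lies within the tolerance, so every walk of the exact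
    -- type of `R k` is admissible.
    filter_upwards [hev, h.tendsto_headLength_mul.eventually_gt_atTop C] with k hk hζ
    obtain ⟨hk, h1, h2, h3, h4⟩ := hk
    refine ⟨exactCount_le_ncard_admissiblePrefixes hk fun e => ?_,
      exactCount_pos hprim h1 h2 h3 hk root,
      poolExponent_le_logb_exactCount hprim h1 h2 h3 hk root⟩
    have hmk : (0 : ℝ) < m k := by exact_mod_cast hk
    rw [abs_sub_comm]
    refine (h4 e).trans_lt ?_
    rw [div_lt_iff₀ hmk, mul_comm]
    exact hζ
  refine ⟨⟨fun k => (m k : ℝ) / N k * (poolExponent G (R k) root (m k) / m k),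
    (tendsto_headLength_div h.tendsto_length h.alpha_pos).mul
      (tendsto_poolExponent_div root hprim hP hm hRlim), ?_⟩, ?_⟩
  · filter_upwards [hcount, h.tendsto_length.eventually_ge_atTop 1] with k hk hN
    rw [h.poolRate_eq hdet hprim root hN]
    refine mul_le_mul_of_nonneg_left (div_le_div_of_nonneg_right ?_ (Nat.cast_nonneg _))
      (by positivity)
    refine hk.2.2.trans (Real.logb_le_logb_of_le one_lt_two ?_ ?_)
    · exact_mod_cast hk.2.1
    · exact_mod_cast hk.1
  · filter_upwards [hcount] with k hk
    exact hk.2.1.trans_le hk.1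

theorem tendsto_poolRate (h : IsPoolSequence G P Q N α ζ) (hP : P.IsPositive)
    (hdet : G.IsDeterministic) (hprim : G.IsPrimitive) (root : V)
    (hζ : Tendsto ζ atTop (𝓝 0)) :
    Tendsto (fun k => poolRate G (Q k) root α (ζ k) (N k)) atTop
      (𝓝 (α * P.entropyRate G)) := by
  obtain ⟨⟨g, hg, hgle⟩, hpos⟩ := h.exists_le_poolRate hP hdet hprim root
  set q := P.transProb G with hq
  have hqpos : ∀ e, 0 < q e := fun e => P.transProb_pos (hP e)
  -- A ζ-typical prefix has probability at least 2^(-n' T) under the limit chain `P`. `T` is a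
  -- cross-entropy plus the largest effect of the tolerance and tends to H(P).
  set T : ℕ → ℝ := fun k => -∑ e, (Q k).prob e * Real.logb 2 (q e) +
    ζ k * ∑ e, |Real.logb 2 (q e)| with hT
  have hTlim : Tendsto T atTop (𝓝 (P.entropyRate G)) := by
    have h1 := (tendsto_finsetSum Finset.univ fun e _ =>
      (h.tendsto_prob e).mul_const (Real.logb 2 (q e))).neg.add
      (hζ.mul_const (∑ e, |Real.logb 2 (q e)|))
    rw [zero_mul, add_zero] at h1
    exact h1
  refine tendsto_of_tendsto_of_tendsto_of_le_of_le' hg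
    ((tendsto_headLength_div h.tendsto_length h.alpha_pos).mul hTlim) hgle ?_
  filter_upwards [hpos, h.tendsto_length.eventually_ge_atTop 1,
    (tendsto_headLength h.tendsto_length h.alpha_pos).eventually_ge_atTop 1] with k hk hN hm
  rw [h.poolRate_eq hdet hprim root hN]
  have hm' : (0 : ℝ) < headLength α (N k) := by exact_mod_cast hm
  refine mul_le_mul_of_nonneg_left ?_ (by positivity)
  rw [div_le_iff₀ hm']
  set M : ℝ := (headLength α (N k) : ℝ)
  set S := admissiblePrefixes G (Q k) root α (ζ k) (N k) with hS
  have h1 : (S.ncard : ℝ) * 2 ^ (-(T k * M)) ≤ 1 := by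
    refine ncard_mul_le_one (fun e => (hqpos e).le) P.sum_transProb_le_one
      (fun w hw => ⟨hw.1, hw.2.1⟩) fun w hw => ?_
    have hprod : ∏ e, q e ^ w.count e = 2 ^ (∑ e, (w.count e : ℝ) * Real.logb 2 (q e)) := by
      rw [Real.rpow_sum_of_pos two_pos]
      refine Finset.prod_congr rfl fun e _ => ?_
      rw [mul_comm, Real.rpow_mul two_pos.le, Real.rpow_logb two_pos (by norm_num) (hqpos e),
        Real.rpow_natCast]
    rw [hprod]
    refine Real.rpow_le_rpow_of_exponent_le one_le_two ?_
    rw [hT]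
    simp only [neg_mul, add_mul, neg_add, neg_neg, Finset.sum_mul, Finset.mul_sum]
    rw [← sub_eq_add_neg, ← Finset.sum_sub_distrib]
    refine Finset.sum_le_sum fun e _ => ?_
    have h2 := hw.2.2 e
    have h3 : (w.count e : ℝ) = M * (w.count e / M) := by field_simp
    have h4 : |(w.count e / M - (Q k).prob e) * Real.logb 2 (q e)| ≤
        ζ k * |Real.logb 2 (q e)| := by
      rw [abs_mul]; exact mul_le_mul_of_nonneg_right h2.le (abs_nonneg _)
    have h5 := mul_le_mul_of_nonneg_left (neg_le_of_abs_le h4) hm'.le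
    rw [h3]
    linarith
  have h2 : (S.ncard : ℝ) ≤ 2 ^ (T k * M) := by
    rw [Real.rpow_neg two_pos.le, ← div_eq_mul_inv, div_le_one (by positivity)] at h1
    exact h1
  rw [Real.logb_le_iff_le_rpow one_lt_two (by exact_mod_cast hk)]
  exact h2

end IsPoolSequence

end Rate

/-! ### Existence of the capacity; maxentropic chains exist and are positive. -/

section Capacity

namespace LabeledGraph

variable {V E A : Type*} {G : LabeledGraph V E A}

/-- The words of length `l` of the constrained system. -/
def wordsOfLength (G : LabeledGraph V E A) (l : ℕ) : Set (List A) :=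
  G.constrainedSystem ∩ {c | c.length = l}

theorem wordsOfLength_finite [Finite A] (G : LabeledGraph V E A) (l : ℕ) :
    (G.wordsOfLength l).Finite :=
  (List.finite_length_eq A l).subset fun _ h => h.2

theorem exists_isWalk_length (h : ∀ u, ∃ e, G.src e = u) (l : ℕ) (u : V) :
    ∃ p v, G.IsWalk u p v ∧ p.length = l := by
  induction l generalizing u with
  | zero => exact ⟨[], u, rfl, rfl⟩
  | succ l ih =>
    obtain ⟨e, he⟩ := h u
    obtain ⟨p, v, hp, hl⟩ := ih (G.tgt e)
    exact ⟨e :: p, v, ⟨he, hp⟩, by simp [hl]⟩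

theorem ncard_wordsOfLength_pos [Finite A] (hprim : G.IsPrimitive) (root : V) (l : ℕ) :
    0 < (G.wordsOfLength l).ncard := by
  obtain ⟨p, v, hp, hl⟩ := exists_isWalk_length hprim.exists_src_eq l root
  exact (Set.ncard_pos (G.wordsOfLength_finite l)).2
    ⟨G.word p, ⟨root, p, v, hp, rfl⟩, by simpa [word] using hl⟩

theorem ncard_wordsOfLength_add_le [Finite A] (a b : ℕ) :
    (G.wordsOfLength (a + b)).ncard ≤ (G.wordsOfLength a).ncard * (G.wordsOfLength b).ncard := by
  rw [← Set.ncard_prod]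
  refine Set.ncard_le_ncard_of_injOn (fun c => (c.take a, c.drop a)) ?_ ?_
    ((G.wordsOfLength_finite a).prod (G.wordsOfLength_finite b))
  · rintro _ ⟨⟨u, p, v, hp, rfl⟩, hl⟩
    have hl' : p.length = a + b := by simpa [word] using hl
    rw [← List.take_append_drop a p] at hp
    obtain ⟨x, h1, h2⟩ := isWalk_append.1 hp
    refine ⟨⟨⟨u, _, x, h1, ?_⟩, ?_⟩, ⟨⟨x, _, v, h2, ?_⟩, ?_⟩⟩ <;>
      simp [word, List.map_take, List.map_drop, hl']
  · intro c _ c' _ h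
    rw [← List.take_append_drop a c, ← List.take_append_drop a c', (Prod.mk.inj h).1,
      (Prod.mk.inj h).2]

theorem growthRate_eq (G : LabeledGraph V E A) (l : ℕ) :
    G.growthRate l = Real.logb 2 ((G.wordsOfLength l).ncard : ℝ) / l := by
  rw [growthRate, one_div_mul_eq_div]; rfl

/-- Fekete's lemma: cutting a word in two makes the word counts submultiplicative. -/
theorem tendsto_growthRate [Finite A] (hprim : G.IsPrimitive) (root : V) :
    Tendsto G.growthRate atTop (𝓝 G.capacity) := by
  have hpos := fun l => ncard_wordsOfLength_pos (A := A) hprim root l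
  have hsub : Subadditive fun l => Real.logb 2 ((G.wordsOfLength l).ncard : ℝ) := by
    intro a b
    have ha : ((G.wordsOfLength a).ncard : ℝ) ≠ 0 := by exact_mod_cast (hpos a).ne'
    have hb : ((G.wordsOfLength b).ncard : ℝ) ≠ 0 := by exact_mod_cast (hpos b).ne'
    simp only
    rw [← Real.logb_mul ha hb]
    exact Real.logb_le_logb_of_le one_lt_two (by exact_mod_cast hpos _)
      (by exact_mod_cast ncard_wordsOfLength_add_le a b)
  have h := hsub.tendsto_lim ⟨0, by
    rintro _ ⟨l, rfl⟩
    exact div_nonneg (Real.logb_nonneg one_lt_two (by exact_mod_cast hpos l)) (Nat.cast_nonneg _)⟩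
  have h' : Tendsto G.growthRate atTop (𝓝 hsub.lim) :=
    h.congr fun l => (G.growthRate_eq l).symm
  rwa [capacity, h'.limUnder_eq]

/-- A set of walks from a common vertex has at most as many elements as there are words. -/
theorem ncard_le_ncard_wordsOfLength [Finite A] (hdet : G.IsDeterministic) {u : V} {l : ℕ}
    {S : Set (List E)} (hS : ∀ w ∈ S, (∃ v, G.IsWalk u w v) ∧ w.length = l) :
    S.ncard ≤ (G.wordsOfLength l).ncard := by
  refine Set.ncard_le_ncard_of_injOn G.word ?_ ?_ (G.wordsOfLength_finite l)
  · intro w hw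
    obtain ⟨⟨v, hv⟩, hl⟩ := hS w hw
    exact ⟨⟨u, w, v, hv, rfl⟩, by simpa [word] using hl⟩
  · intro w hw w' hw' h
    obtain ⟨⟨v, hv⟩, -⟩ := hS w hw
    obtain ⟨⟨v', hv'⟩, -⟩ := hS w' hw'
    exact hv.word_injective hdet hv' h

end LabeledGraph

variable {V E A : Type*} [Fintype V] [DecidableEq V] [Fintype E] {G : LabeledGraph V E A}

namespace EdgeChain

omit [Fintype V] in
-- Every edge lies on a closed walk through the root; the summed counts of these walks form a
-- positive circulation.
theorem exists_stationary_positive (hprim : G.IsPrimitive) (root : V) :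
    ∃ Q : EdgeChain E, Q.IsStationary G ∧ Q.IsPositive := by
  classical
  have hcyc : ∀ e, ∃ c, G.IsWalk root c root ∧ e ∈ c := by
    intro e
    obtain ⟨p, hp⟩ := hprim.exists_isWalk root (G.src e)
    obtain ⟨q, hq⟩ := hprim.exists_isWalk (G.tgt e) root
    exact ⟨p ++ e :: q, isWalk_append.2 ⟨_, hp, rfl, hq⟩, by simp⟩
  choose c hc hmem using hcyc
  set y : E → ℕ := fun f => ∑ e, (c e).count f with hy
  have hypos : ∀ f, 0 < y f := fun f => (List.count_pos_iff.2 (hmem f)).trans_le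
    (Finset.single_le_sum (f := fun e => (c e).count f) (fun _ _ => Nat.zero_le _)
      (Finset.mem_univ f))
  obtain ⟨e₀, -⟩ := hprim.exists_src_eq root
  have hn : 0 < ∑ f, y f := Finset.sum_pos (fun f _ => hypos f) ⟨e₀, Finset.mem_univ _⟩
  refine ⟨ofCounts y _ hn.ne' rfl, ofCounts_isStationary _ _ _ _ fun u => ?_, fun e => ?_⟩
  · simp only [outFlow, inFlow, hy]
    rw [Finset.sum_comm, Finset.sum_comm (s := Finset.univ.filter fun e => G.tgt e = u)]
    refine Finset.sum_congr rfl fun e _ => ?_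
    have := (hc e).isBalanced u
    simp only [outFlow, inFlow] at this
    omega
  · have := hypos e
    simp only [ofCounts]
    positivity

theorem exists_isMaxentropic (hprim : G.IsPrimitive) (root : V) :
    ∃ P : EdgeChain E, P.IsMaxentropic G := by
  set K : Set (E → ℝ) := stdSimplex ℝ E ∩ {p | ∀ u, G.outFlow p u = G.inFlow p u} with hK
  have hKc : IsCompact K := by
    refine (isCompact_stdSimplex ℝ E).inter_right ?_
    simp only [Set.ofPred_forall]
    refine isClosed_iInter fun u => isClosed_eq ?_ ?_ <;> simp only [outFlow, inFlow] <;> fun_prop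
  obtain ⟨Q, hQ, -⟩ := exists_stationary_positive hprim root
  obtain ⟨p, hp, hmax⟩ := hKc.exists_isMaxOn
    ⟨Q.prob, ⟨Q.nonneg, Q.sum_eq_one⟩, hQ⟩
    (f := fun p => ∑ e, Real.negMulLog (p e) - ∑ u, Real.negMulLog (G.outFlow p u)) (by
      refine Continuous.continuousOn ?_
      simp only [outFlow]
      exact (continuous_finsetSum _ fun e _ => Real.continuous_negMulLog.comp
        (continuous_apply e)).sub (continuous_finsetSum _ fun u _ =>
          Real.continuous_negMulLog.comp (continuous_finsetSum _ fun e _ => continuous_apply e)))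
  refine ⟨⟨p, hp.1.1, hp.1.2⟩, hp.2, fun R hR => ?_⟩
  rw [← mul_le_mul_iff_left₀ (Real.log_pos one_lt_two), entropyRate_mul_log_two,
    entropyRate_mul_log_two]
  exact hmax (show R.prob ∈ K from ⟨⟨R.nonneg, R.sum_eq_one⟩, hR⟩)

/-- The mixture `(1 - t) P + t Q`. -/
noncomputable def mix (P Q : EdgeChain E) (t : ℝ) (h0 : 0 ≤ t) (h1 : t ≤ 1) : EdgeChain E where
  prob e := (1 - t) * P.prob e + t * Q.prob e
  nonneg e := add_nonneg (mul_nonneg (by linarith) (P.nonneg e)) (mul_nonneg h0 (Q.nonneg e))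
  sum_eq_one := by
    rw [Finset.sum_add_distrib, ← Finset.mul_sum, ← Finset.mul_sum, P.sum_eq_one, Q.sum_eq_one]
    ring

omit [Fintype V] in
theorem vertexProb_mix (P Q : EdgeChain E) (t : ℝ) (h0 : 0 ≤ t) (h1 : t ≤ 1) (u : V) :
    (P.mix Q t h0 h1).vertexProb G u = (1 - t) * P.vertexProb G u + t * Q.vertexProb G u := by
  simp only [vertexProb, mix, Finset.sum_add_distrib, Finset.mul_sum]

omit [Fintype V] in
theorem mix_isStationary {P Q : EdgeChain E} (hP : P.IsStationary G) (hQ : Q.IsStationary G)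
    (t : ℝ) (h0 : 0 ≤ t) (h1 : t ≤ 1) : (P.mix Q t h0 h1).IsStationary G := by
  intro u
  rw [vertexProb_mix, hP u, hQ u]
  simp only [mix, Finset.sum_add_distrib, Finset.mul_sum]

omit [Fintype V] in
theorem entropyRate_mul_log_two' (P : EdgeChain E) (G : LabeledGraph V E A) :
    P.entropyRate G * Real.log 2 =
      ∑ e, P.prob e * Real.log (P.vertexProb G (G.src e) / P.prob e) := by
  rw [entropyRate, neg_mul, Finset.sum_mul, ← Finset.sum_neg_distrib]
  refine Finset.sum_congr rfl fun e _ => ?_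
  rw [mul_assoc, logb_two_mul_log_two, ← inv_div, Real.log_inv]
  ring

omit [Fintype V] in
/-- A stationary chain that is not positive has an edge of mass zero leaving a vertex of positive
mass. -/
theorem exists_prob_eq_zero_vertexProb_pos (hprim : G.IsPrimitive) {P : EdgeChain E}
    (hS : P.IsStationary G) (hP : ¬P.IsPositive) :
    ∃ e, P.prob e = 0 ∧ 0 < P.vertexProb G (G.src e) := by
  by_contra! hall
  have hstep : ∀ e, 0 < P.vertexProb G (G.src e) → 0 < P.prob e := fun e he =>
    (P.nonneg e).lt_of_ne fun h => (hall e h.symm).not_gt he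
  -- If every edge leaving a charged vertex is charged, stationarity carries positive mass along all
  -- walks, hence to every vertex.
  have hwalk : ∀ (p : List E) (u v : V), G.IsWalk u p v → 0 < P.vertexProb G u →
      0 < P.vertexProb G v := by
    intro p
    induction p with
    | nil => rintro u v rfl h; exact h
    | cons e p ih =>
      rintro u v ⟨rfl, hp⟩ h
      refine ih _ _ hp ((hstep e h).trans_le ?_)
      rw [hS]
      exact Finset.single_le_sum (f := P.prob) (fun e _ => P.nonneg e) (by simp)
  obtain ⟨e, he⟩ : ∃ e, 0 < P.prob e := by
    by_contra! h
    have := Finset.sum_nonpos fun e (_ : e ∈ Finset.univ) => h e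
    rw [P.sum_eq_one] at this
    linarith
  refine hP fun f => hstep f ?_
  obtain ⟨p, hp⟩ := hprim.exists_isWalk (G.src e) (G.src f)
  exact hwalk p _ _ hp (he.trans_le (P.prob_le_vertexProb G e))

end EdgeChain

/-- The log-sum inequality, obtained by adding two tangent-line bounds log z ≤ z - 1. The
assumptions `a ≤ c` and `b ≤ d` keep the logarithms meaningful when a mass vanishes. -/
theorem mul_log_div_superadditive {a b c d : ℝ} (ha : 0 ≤ a) (hb : 0 ≤ b) (hac : a ≤ c)
    (hbd : b ≤ d) :
    a * Real.log (c / a) + b * Real.log (d / b) ≤ (a + b) * Real.log ((c + d) / (a + b)) := by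
  rcases ha.eq_or_lt with rfl | ha
  · rcases hb.eq_or_lt with rfl | hb
    · simp
    · simp only [zero_mul, zero_add]
      refine mul_le_mul_of_nonneg_left (Real.log_le_log (div_pos (hb.trans_le hbd) hb) ?_) hb.le
      exact div_le_div_of_nonneg_right (by linarith) hb.le
  rcases hb.eq_or_lt with rfl | hb
  · simp only [zero_mul, add_zero]
    refine mul_le_mul_of_nonneg_left (Real.log_le_log (div_pos (ha.trans_le hac) ha) ?_) ha.le
    exact div_le_div_of_nonneg_right (by linarith) ha.le
  have hc := ha.trans_le hac
  have hd := hb.trans_le hbd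
  have key : ∀ x y : ℝ, 0 < x → 0 < y →
      x * Real.log (y / x) ≤ x * Real.log ((c + d) / (a + b)) + y * (a + b) / (c + d) - x := by
    intro x y hx hy
    have h1 := Real.log_le_sub_one_of_pos (show 0 < (y / x) / ((c + d) / (a + b)) by positivity)
    rw [Real.log_div (by positivity) (by positivity)] at h1
    have h2 := mul_le_mul_of_nonneg_left h1 hx.le
    have h3 : x * ((y / x) / ((c + d) / (a + b)) - 1) = y * (a + b) / (c + d) - x := by
      field_simp
    linarith
  have h1 := key a c ha hc
  have h2 := key b d hb hd
  have h3 : c * (a + b) / (c + d) + d * (a + b) / (c + d) = a + b := by field_simp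
  linarith

theorem EdgeChain.IsMaxentropic.isPositive (hprim : G.IsPrimitive) {P : EdgeChain E}
    (hP : P.IsMaxentropic G) : P.IsPositive := by
  classical
  by_contra hnot
  have hne : Nonempty V := by
    by_contra h
    rw [not_nonempty_iff] at h
    have := P.sum_vertexProb G
    simp at this
  obtain ⟨Q, hQS, hQ⟩ := EdgeChain.exists_stationary_positive hprim hne.some
  obtain ⟨e₀, he₀, hπ⟩ := EdgeChain.exists_prob_eq_zero_vertexProb_pos hprim hP.1 hnot
  set g : EdgeChain E → E → ℝ := fun R e =>
    R.prob e * Real.log (R.vertexProb G (G.src e) / R.prob e) with hg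
  have hE : ∀ R : EdgeChain E, R.entropyRate G * Real.log 2 = ∑ e, g R e := fun R =>
    R.entropyRate_mul_log_two' G
  have hQ0 := hQ e₀
  set c := P.vertexProb G (G.src e₀) with hc
  set b := Q.prob e₀ with hb
  -- Mixing in weight t of `Q` loses at most `t * b * K` by concavity on the edges other than `e₀`.
  -- The vertex mass stays at least c/2, so the next choice of `t` makes the logarithm at `e₀` at
  -- least `K + 1`, a net gain of `t * b`.
  set K := (∑ e, g P e - ∑ e, g Q e + g Q e₀) / b with hK
  set t := min (1 / 2) (c / (2 * b) * Real.exp (-(K + 1))) with ht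
  have ht0 : 0 < t := lt_min (by norm_num) (by positivity)
  have ht2 : t ≤ 1 / 2 := min_le_left _ _
  have ht1 : t ≤ 1 := by linarith
  set R := P.mix Q t ht0.le ht1 with hR
  have hscale : ∀ (s : ℝ) (S : EdgeChain E) (e : E), 0 < s →
      s * S.prob e * Real.log (s * S.vertexProb G (G.src e) / (s * S.prob e)) = s * g S e := by
    intro s S e hs
    rw [mul_div_mul_left _ _ hs.ne', mul_assoc]
  have h1 : ∀ e, (1 - t) * g P e + t * g Q e ≤ g R e := by
    intro e
    have := mul_log_div_superadditive (a := (1 - t) * P.prob e) (b := t * Q.prob e)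
      (mul_nonneg (by linarith) (P.nonneg e)) (mul_nonneg ht0.le (Q.nonneg e))
      (mul_le_mul_of_nonneg_left (P.prob_le_vertexProb G e) (by linarith : 0 ≤ 1 - t))
      (mul_le_mul_of_nonneg_left (Q.prob_le_vertexProb G e) ht0.le)
    rw [hscale _ _ _ (by linarith), hscale _ _ _ ht0] at this
    rw [hg]
    simp only [hR, EdgeChain.vertexProb_mix]
    exact this
  have h2 : t * (b * (K + 1)) ≤ g R e₀ := by
    have h3 : R.prob e₀ = t * b := by simp [hR, EdgeChain.mix, he₀, hb]
    have h4 : c / 2 ≤ R.vertexProb G (G.src e₀) := by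
      rw [hR, EdgeChain.vertexProb_mix]
      have := mul_nonneg ht0.le (Q.vertexProb_nonneg G (G.src e₀))
      nlinarith
    rw [hg]
    simp only
    rw [h3, ← mul_assoc]
    refine mul_le_mul_of_nonneg_left ?_ (by positivity)
    rw [Real.le_log_iff_exp_le (div_pos (by linarith) (by positivity)), le_div_iff₀ (by positivity)]
    refine le_trans ?_ h4
    have h5 : t ≤ c / (2 * b) * Real.exp (-(K + 1)) := min_le_right _ _
    have h6 : Real.exp (K + 1) * (t * b) ≤
        Real.exp (K + 1) * (c / (2 * b) * Real.exp (-(K + 1)) * b) := by gcongr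
    refine h6.trans_eq ?_
    rw [Real.exp_neg]
    field_simp
  have h3 : (1 - t) * (∑ e, g P e - g P e₀) + t * (∑ e, g Q e - g Q e₀) + t * (b * (K + 1)) ≤
      ∑ e, g R e := by
    rw [← Finset.add_sum_erase _ (g P) (Finset.mem_univ e₀),
      ← Finset.add_sum_erase _ (g Q) (Finset.mem_univ e₀),
      ← Finset.add_sum_erase _ (g R) (Finset.mem_univ e₀), add_sub_cancel_left,
      add_sub_cancel_left, Finset.mul_sum, Finset.mul_sum, ← Finset.sum_add_distrib, add_comm]
    exact add_le_add h2 (Finset.sum_le_sum fun e _ => h1 e)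
  have h4 : ∑ e, g R e ≤ ∑ e, g P e := by
    rw [← hE, ← hE]
    exact mul_le_mul_of_nonneg_right (hP.2 R (EdgeChain.mix_isStationary hP.1 hQS _ _ _))
      (Real.log_pos one_lt_two).le
  have h5 : g P e₀ = 0 := by simp [hg, he₀]
  have h6 : b * K = ∑ e, g P e - ∑ e, g Q e + g Q e₀ := by rw [hK]; field_simp
  have h7 : t * b > 0 := by positivity
  have h8 : t * (b * (K + 1)) = t * (∑ e, g P e - ∑ e, g Q e + g Q e₀) + t * b := by
    rw [← h6]; ring
  rw [h5, h8] at h3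
  nlinarith

end Capacity

/-! ### The method of types. -/

section Types

variable {V E A : Type*} [DecidableEq V] [Fintype E] {G : LabeledGraph V E A}

/-- All walks of one closed type have probability 2^(-M H(Q)) under their common empirical chain
`Q`, which is stationary and so has H(Q) ≤ H(P). -/
theorem ncard_typedWalks_le [DecidableEq E] {P : EdgeChain E} (hP : P.IsMaxentropic G) {M : ℕ}
    (hM : M ≠ 0) {m : E → ℕ} (hm : ∑ e, m e = M) (u : V) :
    ((G.typedWalks m u u).ncard : ℝ) ≤ 2 ^ (M * P.entropyRate G) := by
  rcases (G.typedWalks m u u).eq_empty_or_nonempty with h0 | ⟨w₀, hw₀⟩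
  · rw [h0, Set.ncard_empty, Nat.cast_zero]; positivity
  have hbal : ∀ i, G.outFlow m i = G.inFlow m i := fun i => by
    have := hw₀.1.isBalanced i
    rw [funext hw₀.2] at this
    omega
  set Q := EdgeChain.ofCounts m M hM hm with hQ
  have hQS : Q.IsStationary G := EdgeChain.ofCounts_isStationary _ _ _ _ hbal
  have hM' : (M : ℝ) ≠ 0 := by exact_mod_cast hM
  have hmQ : ∀ e, (m e : ℝ) = M * Q.prob e := fun e => by
    simp only [hQ, EdgeChain.ofCounts]; field_simp
  have h1 : ((G.typedWalks m u u).ncard : ℝ) * 2 ^ (-(M * Q.entropyRate G)) ≤ 1 := by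
    refine ncard_mul_le_one (G := G) (l := M) (u := u) Q.transProb_nonneg Q.sum_transProb_le_one
      (fun w hw => ⟨⟨u, hw.1⟩, (typedWalks_length hw).trans hm⟩) fun w hw => ?_
    rw [EdgeChain.entropyRate, mul_neg, neg_neg, Finset.mul_sum, Real.rpow_sum_of_pos two_pos]
    refine Finset.prod_le_prod (fun e _ => by positivity) fun e _ => ?_
    rw [hw.2, ← mul_assoc, ← hmQ, ← EdgeChain.transProb]
    rcases Nat.eq_zero_or_pos (m e) with h | h
    · simp [h]
    · have hpos : 0 < Q.prob e := by
        simp only [hQ, EdgeChain.ofCounts]; positivity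
      rw [mul_comm, Real.rpow_mul two_pos.le, Real.rpow_logb two_pos (by norm_num)
        (Q.transProb_pos hpos), Real.rpow_natCast]
  rw [Real.rpow_neg two_pos.le, ← div_eq_mul_inv, div_le_one (by positivity)] at h1
  refine h1.trans (Real.rpow_le_rpow_of_exponent_le one_le_two ?_)
  exact mul_le_mul_of_nonneg_left (hP.2 Q hQS) (Nat.cast_nonneg _)

/-- Every walk of length `l` extends to a closed walk of length `l + N`, and these fall into
polynomially many types. -/
theorem ncard_walks_le {P : EdgeChain E} (hP : P.IsMaxentropic G) {N : ℕ} (hN : 0 < N)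
    (hwalk : ∀ u v : V, ∃ p : List E, G.IsWalk u p v ∧ p.length = N) (l : ℕ) (u : V) :
    ({w : List E | (∃ v, G.IsWalk u w v) ∧ w.length = l}.ncard : ℝ) ≤
      ((l + N + 1 : ℕ) : ℝ) ^ Fintype.card E * 2 ^ (((l + N : ℕ) : ℝ) * P.entropyRate G) := by
  classical
  choose c hc hl using hwalk
  set M := l + N with hM
  set F : Finset (E → Fin (M + 1)) := Finset.univ.filter fun m => ∑ e, (m e : ℕ) = M
  -- Closing each walk by a fixed walk of length `N` is injective, since the first `l` edges are
  -- kept, and yields closed types, to which maximality of `P` applies.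
  have h1 : {w : List E | (∃ v, G.IsWalk u w v) ∧ w.length = l}.ncard ≤
      (⋃ m ∈ F, G.typedWalks (fun e => (m e : ℕ)) u u).ncard := by
    refine Set.ncard_le_ncard_of_injOn (fun w => w ++ c (G.endVertex u w) u) ?_ ?_
      (Set.Finite.biUnion F.finite_toSet fun m _ => typedWalks_finite _ _ _)
    · rintro w ⟨⟨v, hv⟩, hwl⟩
      set x := w ++ c (G.endVertex u w) u with hx
      have hxw : G.IsWalk u x u :=
        isWalk_append.2 ⟨v, hv, by rw [hv.endVertex_eq]; exact hc v u⟩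
      have hxl : x.length = M := by simp [hx, hwl, hl, hM]
      refine Set.mem_iUnion₂.2 ⟨fun e => ⟨x.count e, ?_⟩, ?_, hxw, fun e => rfl⟩
      · have := x.count_le_length (a := e)
        omega
      · simp only [F, Finset.mem_filter, Finset.mem_univ, true_and]
        rw [sum_count_eq_length, hxl]
    · rintro w ⟨-, hw⟩ w' ⟨-, hw'⟩ h
      exact (List.append_inj h (hw.trans hw'.symm)).1
  have h2 := h1.trans (Finset.set_ncard_biUnion_le _ _)
  have h3 : (∑ m ∈ F, ((G.typedWalks (fun e => (m e : ℕ)) u u).ncard : ℝ)) ≤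
      F.card • (2 : ℝ) ^ ((M : ℝ) * P.entropyRate G) :=
    Finset.sum_le_card_nsmul _ _ _ fun m hm =>
      ncard_typedWalks_le hP (by omega) (Finset.mem_filter.1 hm).2 u
  have h4 : (F.card : ℝ) ≤ ((M + 1 : ℕ) : ℝ) ^ Fintype.card E := by
    have : F.card ≤ (M + 1) ^ Fintype.card E := by
      simpa using Finset.card_le_univ F
    exact_mod_cast this
  refine le_trans (by exact_mod_cast h2) (h3.trans ?_)
  rw [nsmul_eq_mul]
  exact mul_le_mul_of_nonneg_right h4 (by positivity)

theorem ncard_wordsOfLength_le [Fintype V] {P : EdgeChain E} (hP : P.IsMaxentropic G) {N : ℕ}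
    (hN : 0 < N) (hwalk : ∀ u v : V, ∃ p : List E, G.IsWalk u p v ∧ p.length = N) (l : ℕ) :
    ((G.wordsOfLength l).ncard : ℝ) ≤ Fintype.card V *
      (((l + N + 1 : ℕ) : ℝ) ^ Fintype.card E * 2 ^ (((l + N : ℕ) : ℝ) * P.entropyRate G)) := by
  have h1 : G.wordsOfLength l ⊆ ⋃ u ∈ (Finset.univ : Finset V),
      G.word '' {w : List E | (∃ v, G.IsWalk u w v) ∧ w.length = l} := by
    rintro _ ⟨⟨u, p, v, hp, rfl⟩, hl⟩
    exact Set.mem_iUnion₂.2 ⟨u, Finset.mem_univ u, p, ⟨⟨v, hp⟩, by simpa [word] using hl⟩, rfl⟩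
  have hfin := fun u => finite_setOf_isWalk_length (G := G) u l
  have h2 := (Set.ncard_le_ncard h1 (Set.Finite.biUnion (Finset.finite_toSet _)
    fun u _ => (hfin u).image _)).trans (Finset.set_ncard_biUnion_le _ _)
  have h3 : (∑ u : V, ((G.word '' {w : List E | (∃ v, G.IsWalk u w v) ∧ w.length = l}).ncard : ℝ))
      ≤ Finset.univ.card • (((l + N + 1 : ℕ) : ℝ) ^ Fintype.card E *
        (2 : ℝ) ^ (((l + N : ℕ) : ℝ) * P.entropyRate G)) :=
    Finset.sum_le_card_nsmul _ _ _ fun u _ =>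
      le_trans (by exact_mod_cast Set.ncard_image_le (hfin u)) (ncard_walks_le hP hN hwalk l u)
  rw [nsmul_eq_mul, Finset.card_univ] at h3
  exact le_trans (by exact_mod_cast h2) h3

end Types

/-! ### The entropy of a maxentropic chain equals the capacity, and the pool attains it. -/

section CapacityAchieved

variable {V E A : Type*} [Fintype V] [DecidableEq V] [Fintype E] [LinearOrder E] [Fintype A]
  {G : LabeledGraph V E A} {P : EdgeChain E}

omit [LinearOrder E] in
theorem capacity_le_entropyRate (hprim : G.IsPrimitive) (root : V) (hP : P.IsMaxentropic G) :
    G.capacity ≤ P.entropyRate G := by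
  obtain ⟨N, hN, hwalk⟩ := hprim
  have hprim : G.IsPrimitive := ⟨N, hN, hwalk⟩
  have hcast : Tendsto (fun l : ℕ => (l : ℝ)) atTop atTop := tendsto_natCast_atTop_atTop
  have hlog : Tendsto (fun l : ℕ => Real.logb 2 ((l + N + 1 : ℕ) : ℝ) / l) atTop (𝓝 0) := by
    have h1 : Tendsto (fun x : ℝ => Real.log x / (1 * x + -((N : ℝ) + 1))) atTop (𝓝 0) := by
      simpa using Real.tendsto_pow_log_div_mul_add_atTop 1 (-((N : ℝ) + 1)) 1 one_ne_zero
    have h2 := (h1.comp (tendsto_atTop_add_const_right _ ((N : ℝ) + 1) hcast)).div_const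
      (Real.log 2)
    rw [zero_div] at h2
    refine h2.congr fun l => ?_
    simp only [Function.comp, Real.logb]
    push_cast
    rw [div_right_comm]
    congr 2
    · ring_nf
    · ring
  have hlin : Tendsto (fun l : ℕ => ((l + N : ℕ) : ℝ) / l) atTop (𝓝 1) := by
    have h1 := (tendsto_const_nhds (x := (1 : ℝ))).add
      ((tendsto_const_nhds (x := (N : ℝ))).div_atTop hcast)
    rw [add_zero] at h1
    refine h1.congr' ?_
    filter_upwards [eventually_ge_atTop 1] with l hl
    have : (l : ℝ) ≠ 0 := by positivity
    push_cast; field_simp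
  have hlim := (((tendsto_const_nhds (x := Real.logb 2 (Fintype.card V : ℝ))).div_atTop hcast).add
    (hlog.const_mul (Fintype.card E : ℝ))).add (hlin.mul_const (P.entropyRate G))
  simp only [mul_zero, zero_add, one_mul] at hlim
  refine le_of_tendsto_of_tendsto' (tendsto_growthRate hprim root) hlim fun l => ?_
  have hV : (Fintype.card V : ℝ) ≠ 0 := by
    have : 0 < Fintype.card V := Fintype.card_pos_iff.2 ⟨root⟩
    exact_mod_cast this.ne'
  have hpos : (0 : ℝ) < (G.wordsOfLength l).ncard := by
    exact_mod_cast ncard_wordsOfLength_pos hprim root l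
  have h := Real.logb_le_logb_of_le one_lt_two hpos (ncard_wordsOfLength_le hP hN hwalk l)
  rw [Real.logb_mul hV (by positivity), Real.logb_mul (by positivity) (by positivity),
    Real.logb_pow, Real.logb_rpow two_pos (by norm_num)] at h
  rw [growthRate_eq]
  refine (div_le_div_of_nonneg_right h (Nat.cast_nonneg l)).trans_eq ?_
  ring

/-- The closed walks at the root whose type is a rounding of `P` already supply 2^(l H(P) + o(l))
distinct words of length l. -/
theorem entropyRate_le_capacity (hdet : G.IsDeterministic) (hprim : G.IsPrimitive) (root : V)
    (hS : P.IsStationary G) (hP : P.IsPositive) : P.entropyRate G ≤ G.capacity := by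
  obtain ⟨C, R, hev, hRlim⟩ := EdgeChain.exists_seq_isIntegral_near hprim root hP
    (Q := fun _ => P) (fun _ => hS) (fun _ => tendsto_const_nhds) (tendsto_id (α := ℕ))
  refine le_of_tendsto_of_tendsto (tendsto_poolExponent_div root hprim hP tendsto_id hRlim)
    (tendsto_growthRate hprim root) ?_
  filter_upwards [hev] with k hk
  obtain ⟨hk, h1, h2, h3, -⟩ := hk
  simp only [id] at hk h3 ⊢
  rw [growthRate_eq]
  refine div_le_div_of_nonneg_right
    ((poolExponent_le_logb_exactCount hprim h1 h2 h3 hk root).trans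
      (Real.logb_le_logb_of_le one_lt_two ?_ ?_)) (Nat.cast_nonneg k)
  · exact_mod_cast exactCount_pos hprim h1 h2 h3 hk root
  · have := ncard_le_ncard_wordsOfLength hdet (u := root) (l := k)
      (S := {w : List E | G.IsWalk root w root ∧ w.length = k ∧
        ∀ e, (w.count e : ℝ) = (k : ℝ) * (R k).prob e}) fun w hw => ⟨⟨root, hw.1⟩, hw.2.1⟩
    exact_mod_cast this

theorem EdgeChain.IsMaxentropic.entropyRate_eq (hP : P.IsMaxentropic G) (hdet : G.IsDeterministic)
    (hprim : G.IsPrimitive) (root : V) : P.entropyRate G = G.capacity :=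
  le_antisymm (entropyRate_le_capacity hdet hprim root hP.1 (hP.isPositive hprim))
    (capacity_le_entropyRate hprim root hP)

/-- The upper bound counts all words of length n' and ignores typicality, which is why the
tolerances need not tend to 0. -/
theorem IsPoolSequence.tendsto_poolRate_capacity {Q : ℕ → EdgeChain E} {N : ℕ → ℕ} {α : ℝ}
    {ζ : ℕ → ℝ} (h : IsPoolSequence G P Q N α ζ) (hP : P.IsMaxentropic G)
    (hdet : G.IsDeterministic) (hprim : G.IsPrimitive) (root : V) :
    Tendsto (fun k => poolRate G (Q k) root α (ζ k) (N k)) atTop (𝓝 (α * G.capacity)) := by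
  obtain ⟨⟨g, hg, hgle⟩, hpos⟩ := h.exists_le_poolRate (hP.isPositive hprim) hdet hprim root
  rw [hP.entropyRate_eq hdet hprim root] at hg
  refine tendsto_of_tendsto_of_tendsto_of_le_of_le' hg
    ((tendsto_headLength_div h.tendsto_length h.alpha_pos).mul
      ((tendsto_growthRate hprim root).comp (tendsto_headLength h.tendsto_length h.alpha_pos)))
    hgle ?_
  filter_upwards [hpos, h.tendsto_length.eventually_ge_atTop 1] with k hk hN
  rw [h.poolRate_eq hdet hprim root hN, Function.comp, growthRate_eq]
  refine mul_le_mul_of_nonneg_left (div_le_div_of_nonneg_right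
    (Real.logb_le_logb_of_le one_lt_two ?_ ?_) (Nat.cast_nonneg _)) (by positivity)
  · exact_mod_cast hk
  · have := ncard_le_ncard_wordsOfLength hdet
      (S := admissiblePrefixes G (Q k) root α (ζ k) (N k)) fun w hw => ⟨hw.1, hw.2.1⟩
    exact_mod_cast this

omit [LinearOrder E] [Fintype A] in
theorem EdgeChain.exists_isIntegral_near_of_isPositive (hprim : G.IsPrimitive) (root : V)
    (hS : P.IsStationary G) (hP : P.IsPositive) :
    ∃ (C : ℝ) (n₀ : ℕ), ∀ n, n₀ ≤ n → ∃ Q : EdgeChain E,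
        Q.IsStationary G ∧ Q.IsPositive ∧ Q.IsIntegral n ∧
          ∀ e, |P.prob e - Q.prob e| ≤ C / (n : ℝ) := by
  obtain ⟨C, -, hC⟩ := EdgeChain.exists_isIntegral_near hprim root
  have hev : ∀ᶠ n : ℕ in atTop, 1 ≤ n ∧ ∀ e, C < n * P.prob e :=
    (eventually_ge_atTop 1).and (eventually_all.2 fun e =>
      (tendsto_natCast_atTop_atTop.atTop_mul_const (hP e)).eventually_gt_atTop C)
  obtain ⟨n₀, hn₀⟩ := eventually_atTop.1 hev
  exact ⟨C, n₀, fun n hn => hC P n hS (hn₀ n hn).1 (hn₀ n hn).2⟩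

omit [Fintype A] in
theorem finite_length_bound (hdet : G.IsDeterministic) (hprim : G.IsPrimitive)
    (root : V) {n : ℕ} {α ζ : ℝ} (hS : P.IsStationary G) (hP : P.IsPositive) (hn : 1 ≤ n)
    (hi : P.IsIntegral n) (hα : 0 < α) (hα1 : α < 1) (hζ : IsTypicality P α ζ)
    (hm : 1 ≤ headLength α n) (him : P.IsIntegral (headLength α n)) :
    (∑ v, exactCount G P root v (headLength α n)) ≤ (pool G P root α ζ n).ncard ∧
      (2 : ℝ) ^ poolExponent G P root (headLength α n) ≤ ((pool G P root α ζ n).ncard : ℝ) ∧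
      poolExponent G P root (headLength α n) / (n : ℝ) ≤ poolRate G P root α ζ n := by
  have h1 : exactCount G P root root (headLength α n) ≤ (pool G P root α ζ n).ncard := by
    rw [ncard_pool hdet hprim hS hP hn hi hα hα1 hζ]
    exact exactCount_le_ncard_admissiblePrefixes hm fun e => by simpa using hζ.1
  have h2 : (2 : ℝ) ^ poolExponent G P root (headLength α n) ≤
      ((pool G P root α ζ n).ncard : ℝ) :=
    (two_rpow_poolExponent_le hprim hS hP him hm root).trans (by exact_mod_cast h1)
  refine ⟨?_, h2, ?_⟩
  · rwa [Finset.sum_eq_single root (fun v _ hv => exactCount_eq_zero hS him hv) (by simp)]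
  · rw [poolRate, one_div_mul_eq_div]
    refine div_le_div_of_nonneg_right ?_ (Nat.cast_nonneg n)
    exact (Real.le_logb_iff_rpow_le one_lt_two (lt_of_lt_of_le (by positivity) h2)).2 h2

end CapacityAchieved

end

/-! ### The main theorem. -/

theorem mainTheorem2 {V E A : Type*} [Fintype V] [DecidableEq V] [Fintype E] [LinearOrder E]
    [Fintype A] (G : LabeledGraph V E A) (hdet : G.IsDeterministic) (hprim : G.IsPrimitive)
    (root : V) :
    -- the construction is well defined and every codeword meets the weak constraints exactly
    (∀ (P : EdgeChain E) (n : ℕ) (α ζ : ℝ), P.IsStationary G → P.IsPositive → 1 ≤ n →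
      P.IsIntegral n → 0 < α → α < 1 → IsTypicality P α ζ →
      (∀ w ∈ admissiblePrefixes G P root α ζ n,
        (∀ e, (w.count e : ℝ) < (n : ℝ) * P.prob e) ∧
        IsLeast (completions G P root n w) (firstCompletion G P root n w)) ∧
      (∀ c ∈ pool G P root α ζ n, c.length = n) ∧
      pool G P root α ζ n ⊆ P.eulerCodebook G n ∧
      pool G P root α ζ n ⊆
        G.weaklyConstrainedSystem LabeledGraph.edgeIndicator P.prob (fun _ => 0) ∧
      (pool G P root α ζ n).ncard = (admissiblePrefixes G P root α ζ n).ncard) ∧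
    -- the finite-blocklength bound
    (∀ (P : EdgeChain E) (n : ℕ) (α ζ : ℝ), P.IsStationary G → P.IsPositive → 1 ≤ n →
      P.IsIntegral n → 0 < α → α < 1 → IsTypicality P α ζ →
      1 ≤ headLength α n → P.IsIntegral (headLength α n) →
      (∑ v, exactCount G P root v (headLength α n)) ≤ (pool G P root α ζ n).ncard ∧
      (∀ v, v ≠ root → exactCount G P root v (headLength α n) = 0) ∧
      (exactCount G P root root (headLength α n) : ℝ) =
        (∏ i, (⌊(headLength α n : ℝ) * P.vertexProb G i⌋₊.factorial : ℝ)) /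
          (∏ e, (⌊(headLength α n : ℝ) * P.prob e⌋₊.factorial : ℝ)) *
          P.whittleCofactor G root root ∧
      0 < P.whittleCofactor G root root ∧
      (2 : ℝ) ^ poolExponent G P root (headLength α n) ≤
        (exactCount G P root root (headLength α n) : ℝ) ∧
      (2 : ℝ) ^ poolExponent G P root (headLength α n) ≤ ((pool G P root α ζ n).ncard : ℝ) ∧
      poolExponent G P root (headLength α n) / (n : ℝ) ≤ poolRate G P root α ζ n) ∧
    -- the asymptotic rate
    (∀ (P : EdgeChain E) (Q : ℕ → EdgeChain E) (N : ℕ → ℕ) (α : ℝ) (ζ : ℕ → ℝ),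
      P.IsStationary G → P.IsPositive →
      Tendsto N atTop atTop →
      (∀ k, (Q k).IsStationary G ∧ (Q k).IsPositive ∧ (Q k).IsIntegral (N k)) →
      (∀ e, Tendsto (fun k => (Q k).prob e) atTop (𝓝 (P.prob e))) →
      0 < α → α < 1 → (∀ k, IsTypicality (Q k) α (ζ k)) →
      Tendsto (fun k => (N k : ℝ) * ζ k) atTop atTop →
      (∀ ε : ℝ, 0 < ε →
        ∀ᶠ k in atTop, α * P.entropyRate G - ε ≤ poolRate G (Q k) root α (ζ k) (N k)) ∧
      (Tendsto ζ atTop (𝓝 0) →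
        Tendsto (fun k => poolRate G (Q k) root α (ζ k) (N k)) atTop
          (𝓝 (α * P.entropyRate G)))) ∧
    -- the capacity is attained
    Tendsto G.growthRate atTop (𝓝 G.capacity) ∧
    (∃ P : EdgeChain E, P.IsMaxentropic G) ∧
    (∀ P : EdgeChain E, P.IsMaxentropic G →
      P.IsPositive ∧ P.entropyRate G = G.capacity ∧
      (∃ (C : ℝ) (n₀ : ℕ), ∀ n, n₀ ≤ n → ∃ Q : EdgeChain E,
        Q.IsStationary G ∧ Q.IsPositive ∧ Q.IsIntegral n ∧
          ∀ e, |P.prob e - Q.prob e| ≤ C / (n : ℝ)) ∧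
      (∀ (Q : ℕ → EdgeChain E) (N : ℕ → ℕ) (ζ : ℝ → ℕ → ℝ),
        Tendsto N atTop atTop →
        (∀ k, (Q k).IsStationary G ∧ (Q k).IsPositive ∧ (Q k).IsIntegral (N k)) →
        (∀ e, Tendsto (fun k => (Q k).prob e) atTop (𝓝 (P.prob e))) →
        (∀ α : ℝ, 0 < α → α < 1 → (∀ k, IsTypicality (Q k) α (ζ α k)) ∧
          Tendsto (fun k => (N k : ℝ) * ζ α k) atTop atTop) →
        (∀ α : ℝ, 0 < α → α < 1 →
          Tendsto (fun k => poolRate G (Q k) root α (ζ α k) (N k)) atTop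
            (𝓝 (α * G.capacity))) ∧
        Tendsto (fun α : ℝ =>
            limUnder atTop (fun k => poolRate G (Q k) root α (ζ α k) (N k)))
          (𝓝[<] 1) (𝓝 G.capacity))) := by 
  refine ⟨fun P n α ζ hS hP hn hi hα hα1 hζ => ?_, fun P n α ζ hS hP hn hi hα hα1 hζ hm him => ?_,
    fun P Q N α ζ hS hP hN hQ hlim hα hα1 hζ hNζ => ?_, LabeledGraph.tendsto_growthRate hprim root,
    EdgeChain.exists_isMaxentropic hprim root, fun P hP => ?_⟩
  · obtain ⟨h1, h2, h3⟩ := pool_subset (root := root) hprim hS hP hn hi hα hα1 hζ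
    exact ⟨fun w hw => ⟨count_lt_of_mem_admissiblePrefixes hP hn hα hα1 hζ hw,
      isLeast_firstCompletion hprim hS hP hn hi hα hα1 hζ hw⟩, h1, h2, h3,
      ncard_pool hdet hprim hS hP hn hi hα hα1 hζ⟩
  · obtain ⟨h1, h2, h3⟩ := finite_length_bound hdet hprim root hS hP hn hi hα hα1 hζ hm him
    exact ⟨h1, fun v hv => exactCount_eq_zero hS him hv, exactCount_root_eq hS him hm root,
      whittleCofactor_pos hprim hS hP him hm root,
      two_rpow_poolExponent_le hprim hS hP him hm root, h2, h3⟩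
  · have h : IsPoolSequence G P Q N α ζ := ⟨hN, hQ, hlim, hα, hα1, hζ, hNζ⟩
    refine ⟨fun ε hε => ?_, h.tendsto_poolRate hP hdet hprim root⟩
    obtain ⟨⟨g, hg, hgle⟩, -⟩ := h.exists_le_poolRate hP hdet hprim root
    filter_upwards [hgle, hg.eventually_const_lt (sub_lt_self _ hε)] with k h1 h2
    exact h2.le.trans h1
  · refine ⟨hP.isPositive hprim, hP.entropyRate_eq hdet hprim root,
      EdgeChain.exists_isIntegral_near_of_isPositive hprim root hP.1 (hP.isPositive hprim),
      fun Q N ζ hN hQ hlim hζ => ?_⟩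
    have h : ∀ α : ℝ, 0 < α → α < 1 →
        Tendsto (fun k => poolRate G (Q k) root α (ζ α k) (N k)) atTop (𝓝 (α * G.capacity)) :=
      fun α hα hα1 => IsPoolSequence.tendsto_poolRate_capacity
        ⟨hN, hQ, hlim, hα, hα1, (hζ α hα hα1).1, (hζ α hα hα1).2⟩ hP hdet hprim root
    refine ⟨h, ?_⟩
    have h1 : Tendsto (fun α : ℝ => α * G.capacity) (𝓝[<] 1) (𝓝 G.capacity) := by
      have : Tendsto (fun α : ℝ => α * G.capacity) (𝓝 1) (𝓝 (1 * G.capacity)) :=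
        tendsto_id.mul_const _
      rw [one_mul] at this
      exact this.mono_left nhdsWithin_le_nhds
    refine h1.congr' ?_
    -- The inner limit is known only for α in (0,1), which is a left neighbourhood of 1.
    filter_upwards [Ioo_mem_nhdsLT (zero_lt_one' ℝ)] with α hα
    exact (h α hα.1 hα.2).limUnder_eq.symm
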